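/- Let $(P,\{\cdot,\cdot\})$ be a smooth, finite-dimensional, Hausdorff, second countable Poisson manifold. For $H\in C^\infty(P)$ let $X_H$ be the Hamiltonian vector field, $X_H[F]=\{F,H\}$ for all $F\in C^\infty(P)$, and let $\mathcal E_z=\{X_H(z)\mid H\in C^\infty(P)\}$ be the fibre of the characteristic distribution. The symplectic leaves are the classes of the relation "joined by a finite concatenation of trajectories of Hamiltonian vector fields"; the leaf through $z$ has dimension $\dim\mathcal E_z$. Let $\pi:P\to P/\{\cdot,\cdot\}$ be the projection onto the space of leaves, with the quotient topology. A point is regular if $\dim\mathcal E$ is constant near it, and a leaf is regular if all its points are. A continuous Casimir is a continuous function $C:P\to\mathbb R$ that is constant on the symplectic leaves. Functions separate the regular leaves if for any two distinct regular leaves one of the functions takes different values on them. For a point $x$ of a topological space, $T_2(x)$ is the set of all $y$ such that every open neighborhood of $x$ meets every open neighborhood of $y$. For $z\in P$ and $A\subset P$ put $\overline T_2(z)=\pi^{-1}(T_2(\pi(z)))$ and $\overline T_2(A)=\bigcup_{x\in A}\overline T_2(x)$. $P$ is called $\overline T_2$-idempotent if $\overline T_2(\overline T_2(z))=\overline T_2(z)$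 for all $z\in P$; in this case $x\,\mathcal R\,y\Leftrightarrow y\in\overline T_2(x)$ is an equivalence relation. Let $\pi_{\overline T_2}:P\to P/\mathcal R$ be the projection to the quotient space. (i) Suppose that there are continuous Casimirs $C_i$, $i\in I$, that separate the regular symplectic leaves of $P$ and are such that the map $C=(C_i)_{i\in I}:P\to C(P)\subset\mathbb R^I$ is open onto its image, where $\mathbb R^I$ has the product topology. Then $P$ is $\overline T_2$-idempotent, $\pi_{\overline T_2}$ is an open map, and $\overline T_2(z)=\bigcap_{i\in I}C_i^{-1}(C_i(z))$ for every $z\in P$. (ii) If $P$ is $\overline T_2$-idempotent and $\pi_{\overline T_2}$ is an open map, then there is a family $(C_i)_{i\in I}$ of continuous Casimirs such that $\overline T_2(z)=\bigcap_{i\in I}C_i^{-1}(C_i(z))$ for every $z\in P$. Moreover, in both situations the criteria of the continuous and of the topological energy-Casimir method on $P$ coincide: for every continuous map $F$ from $P$ to a Hausdorff space and every $z\in P$ (in particular, for every equilibrium $z$ of a Hamiltonian vector field $X_H$ and $F=H$ or any continuous conserved quantity $F$ of its flow), there is a family of continuous Casimirs on $P$ whose common level set $S_z$ through $z$ satisfies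 $F^{-1}(F(z))\cap S_z=\{z\}$ if and only if $F^{-1}(F(z))\cap\overline T_2(z)=\{z\}$. -/

import Mathlib

open scoped Manifold ContDiff Topology

universe u

/-! ### `T₂`-sets of a topological space -/

section T2Sets

variable {X : Type*} [TopologicalSpace X]

/-- `T₂(x)`: the points `y` that cannot be separated from `x` by disjoint open sets. -/
def T2Set (x : X) : Set X :=
  {y | ∀ U V : Set X, IsOpen U → IsOpen V → x ∈ U → y ∈ V → (U ∩ V).Nonempty}

end T2Sets

/-! ### Poisson manifolds -/

/-- A Poisson structure on a smooth manifold `P` modelled on `E`: a real bilinear bracket on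
`C^∞(P)` which is a Lie bracket (alternating, Jacobi identity) and a derivation in its first entry,
hence, by antisymmetry, in each entry. -/
structure PoissonStructure (E : Type*) [NormedAddCommGroup E] [NormedSpace ℝ E]
    (P : Type*) [TopologicalSpace P] [ChartedSpace E P] where
  /-- the bracket `{F, G}` -/
  bracket : C^∞⟮𝓘(ℝ, E), P; ℝ⟯ →ₗ[ℝ] C^∞⟮𝓘(ℝ, E), P; ℝ⟯ →ₗ[ℝ] C^∞⟮𝓘(ℝ, E), P; ℝ⟯
  bracket_self : ∀ F, bracket F F = 0
  jacobi : ∀ F G H,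
    bracket F (bracket G H) + bracket G (bracket H F) + bracket H (bracket F G) = 0
  leibniz : ∀ F G H, bracket (F * G) H = F * bracket G H + bracket F H * G

namespace PoissonStructure

variable {E : Type*} [NormedAddCommGroup E] [NormedSpace ℝ E]
  {P : Type*} [TopologicalSpace P] [ChartedSpace E P]

/-- The tangent vector `v` at `z` is the value `X_H(z)` of the Hamiltonian vector field of `H`:
`dF(z)(v) = {F, H}(z)` for every `F ∈ C^∞(P)`. -/
def IsHamiltonianVector (S : PoissonStructure E P) (H : C^∞⟮𝓘(ℝ, E), P; ℝ⟯) (z : P)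
    (v : TangentSpace 𝓘(ℝ, E) z) : Prop :=
  ∀ F : C^∞⟮𝓘(ℝ, E), P; ℝ⟯, (mfderiv 𝓘(ℝ, E) 𝓘(ℝ, ℝ) F z v : ℝ) = S.bracket F H z

/-- `X` is the Hamiltonian vector field `X_H`: `X[F] = {F, H}` for every `F ∈ C^∞(P)`. -/
def IsHamiltonianVectorField (S : PoissonStructure E P) (H : C^∞⟮𝓘(ℝ, E), P; ℝ⟯)
    (X : (z : P) → TangentSpace 𝓘(ℝ, E) z) : Prop :=
  ∀ z, S.IsHamiltonianVector H z (X z)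

/-- The fibre at `z` of the characteristic distribution, `{X_H(z) | H ∈ C^∞(P)}`. -/
def characteristicSpace (S : PoissonStructure E P) (z : P) :
    Submodule ℝ (TangentSpace 𝓘(ℝ, E) z) where
  carrier := {v | ∃ H, S.IsHamiltonianVector H z v}
  add_mem' := by
    rintro v w ⟨H, hH⟩ ⟨K, hK⟩
    refine ⟨H + K, fun F => ?_⟩
    rw [map_add, map_add]
    exact congrArg₂ (· + ·) (hH F) (hK F)
  zero_mem' := ⟨0, fun F => by rw [map_zero, map_zero]; rfl⟩
  smul_mem' := by
    rintro c v ⟨H, hH⟩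
    refine ⟨c • H, fun F => ?_⟩
    rw [map_smul, map_smul]
    exact congrArg (c • ·) (hH F)

/-- `y` is reached from `x` along a trajectory of some Hamiltonian vector field. -/
def HamiltonianReach (S : PoissonStructure E P) (x y : P) : Prop :=
  ∃ (H : C^∞⟮𝓘(ℝ, E), P; ℝ⟯) (X : (z : P) → TangentSpace 𝓘(ℝ, E) z) (γ : ℝ → P) (a b : ℝ),
    S.IsHamiltonianVectorField H X ∧ a ≤ b ∧ IsMIntegralCurveOn γ X (Set.Icc a b) ∧
      γ a = x ∧ γ b = y

/-- Two points lie on the same symplectic leaf when they are joined by a finite concatenation of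
trajectories of Hamiltonian vector fields. The classes are the maximal integral manifolds of the
characteristic distribution. -/
def leafSetoid (S : PoissonStructure E P) : Setoid P :=
  Relation.EqvGen.setoid S.HamiltonianReach

/-- The space of symplectic leaves `P / {·,·}`, with the quotient topology. -/
abbrev LeafSpace (S : PoissonStructure E P) : Type _ := Quotient S.leafSetoid

/-- The projection `π` of `P` onto its space of symplectic leaves. -/
def leafProj (S : PoissonStructure E P) (z : P) : S.LeafSpace := Quotient.mk S.leafSetoid z

/-- A point is regular when the symplectic leaves that meet some neighbourhood of it all have the
same dimension; the dimension of the leaf through `w` is that of its tangent space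
`S.characteristicSpace w`. -/
def IsRegularPoint (S : PoissonStructure E P) (z : P) : Prop :=
  ∀ᶠ w in 𝓝 z,
    Module.finrank ℝ (S.characteristicSpace w) = Module.finrank ℝ (S.characteristicSpace z)

/-- A leaf is regular when all its points are regular. -/
def IsRegularLeaf (S : PoissonStructure E P) (L : S.LeafSpace) : Prop :=
  ∀ z, S.leafProj z = L → S.IsRegularPoint z

/-- Continuous Casimirs: continuous functions that are constant on the symplectic leaves. -/
def IsContinuousCasimir (S : PoissonStructure E P) (C : P → ℝ) : Prop :=
  Continuous C ∧ ∀ x y, S.leafProj x = S.leafProj y → C x = C y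

/-- The functions `C i` separate the regular symplectic leaves. -/
def SeparatesRegularLeaves (S : PoissonStructure E P) {I : Type*} (C : I → P → ℝ) : Prop :=
  ∀ x y, S.IsRegularLeaf (S.leafProj x) → S.IsRegularLeaf (S.leafProj y) →
    S.leafProj x ≠ S.leafProj y → ∃ i, C i x ≠ C i y

/-- `T̄₂(z) = π⁻¹(T₂(π(z)))`. -/
def T2Bar (S : PoissonStructure E P) (z : P) : Set P :=
  S.leafProj ⁻¹' T2Set (S.leafProj z)

/-- `T̄₂(A) = ⋃_{z ∈ A} T̄₂(z)`. -/
def T2BarOf (S : PoissonStructure E P) (A : Set P) : Set P := ⋃ z ∈ A, S.T2Bar z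

/-- `T̄₂`-idempotency: `T̄₂(T̄₂(z)) = T̄₂(z)` for all `z`. -/
def IsT2BarIdempotent (S : PoissonStructure E P) : Prop :=
  ∀ z, S.T2BarOf (S.T2Bar z) = S.T2Bar z

/-- The relation `x R y ↔ y ∈ T̄₂(x)`, an equivalence relation in the idempotent case. -/
def T2BarRel (S : PoissonStructure E P) (x y : P) : Prop := y ∈ S.T2Bar x

/-- The projection `π_{T̄₂} : P → P / R`, where `P / R` has the quotient topology. -/
def t2BarProj (S : PoissonStructure E P) (z : P) : Quot S.T2BarRel := Quot.mk S.T2BarRel z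

/-- Criterion of the continuous energy-Casimir method (with Casimirs defined on all of `P`) at `z`
for the conserved quantity `F`: for some family of continuous Casimirs, the level set of `F`
through `z` meets the common level set of the family through `z` in `z` only. -/
def ContinuousEnergyCasimirCriterion (S : PoissonStructure E P) {Y : Type*} (F : P → Y)
    (z : P) : Prop :=
  ∃ 𝒞 : Set (P → ℝ), (∀ C ∈ 𝒞, S.IsContinuousCasimir C) ∧
    F ⁻¹' {F z} ∩ ⋂ C ∈ 𝒞, C ⁻¹' {C z} = {z}

/-- Criterion of the topological energy-Casimir method (with the neighbourhood `U = P`) at `z` for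
the conserved quantity `F`: the level set of `F` through `z` meets `T̄₂(z)` in `z` only. -/
def TopologicalEnergyCasimirCriterion (S : PoissonStructure E P) {Y : Type*} (F : P → Y)
    (z : P) : Prop :=
  F ⁻¹' {F z} ∩ S.T2Bar z = {z}

end PoissonStructure

/-! Continuous Casimirs factor through the leaf space and ℝ is Hausdorff, so each is constant on
every `T̄₂(z)`. In (i), let `y` and `z` have the same Casimir values and take open saturated sets `U
∋ z`, `V ∋ y`. The images of `U` and `V` under `C` are relatively open and share a point. Regular
points are open and dense, so there are regular points `w ∈ U`, `v ∈ V` with equal Casimir values.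
Their leaves are regular, hence equal by separation, and `U` meets `V`. Thus `T̄₂`-sets are common
level sets. Idempotency follows, and so does openness of `π_{T̄₂}`, because saturating an open set
amounts to pulling back its image under `C`.

The geometric input is that a leaf through a regular point is regular. It needs the dimension of the
characteristic distribution to be constant on leaves
(`finrank_characteristicSpace_eq_of_leafProj_eq`) and `π` to be open (`isOpenMap_leafProj`).
Hadamard's lemma turns the bracket into a Poisson tensor in charts. The Jacobi identity makes the
tensor invariant along Hamiltonian trajectories, so its rank is preserved. Openness of `π` comes
from continuity of local flows.

In (ii), the relation `R` is closed and its projection open, so `P/R` is locally compact Hausdorff.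
Urysohn functions on it separate points and pull back to the required Casimirs.

For the two criteria, `T̄₂(z)` lies in every Casimir level set through `z`, and one family attains
it. -/

set_option linter.unusedSectionVars false
set_option maxSynthPendingDepth 3

/-! ### Hadamard's lemma -/

section Hadamard

variable {E : Type u} [NormedAddCommGroup E] [NormedSpace ℝ E] [FiniteDimensional ℝ E]

theorem hasFDerivAt_intervalIntegral_of_contDiff {V : Type*} [NormedAddCommGroup V]
    [NormedSpace ℝ V] {h : E × ℝ → V} (hh : ContDiff ℝ 1 h) (x₀ : E) :
    HasFDerivAt (fun x => ∫ t in (0 : ℝ)..1, h (x, t))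
      (∫ t in (0 : ℝ)..1, (fderiv ℝ h (x₀, t)).comp (ContinuousLinearMap.inl ℝ E ℝ)) x₀ := by
  have hc : Continuous fun q : E × ℝ =>
      (fderiv ℝ h q).comp (ContinuousLinearMap.inl ℝ E ℝ) :=
    (hh.continuous_fderiv one_ne_zero).clm_comp continuous_const
  -- Closed balls in `E` are compact, so the derivative has a constant bound, which serves as the
  -- dominating function.
  obtain ⟨M, hM⟩ := ((isCompact_closedBall x₀ 1).prod
    (isCompact_Icc (a := (0 : ℝ)) (b := 1))).exists_bound_of_continuousOn hc.continuousOn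
  have hh0 := hh.continuous
  refine intervalIntegral.hasFDerivAt_integral_of_dominated_of_fderiv_le
    (F := fun x t => h (x, t))
    (F' := fun x t => (fderiv ℝ h (x, t)).comp (ContinuousLinearMap.inl ℝ E ℝ))
    (bound := fun _ => M)
    (Metric.closedBall_mem_nhds x₀ one_pos) ?_ ?_ ?_ ?_ ?_ ?_
  · exact .of_forall fun x => (by fun_prop : Continuous fun t => h (x, t)).aestronglyMeasurable
  · exact (by fun_prop : Continuous fun t => h (x₀, t)).intervalIntegrable _ _
  · exact (hc.comp (by fun_prop : Continuous fun t : ℝ => (x₀, t))).aestronglyMeasurable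
  · refine .of_forall fun t ht x hx => hM (x, t) ⟨hx, ?_⟩
    rw [Set.uIoc_of_le zero_le_one] at ht
    exact Set.Ioc_subset_Icc_self ht
  · exact intervalIntegrable_const
  · refine .of_forall fun t _ x _ => ?_
    exact ((hh.differentiable one_ne_zero) (x, t)).hasFDerivAt.comp x (hasFDerivAt_prodMk_left x t)

/-- The derivative is again a parametric integral, now with values in `E →L[ℝ] V`. The induction
therefore ranges over all targets `V`; placing `V` in the universe of `E` keeps these targets in
range. -/
theorem contDiff_intervalIntegral {V : Type u} [NormedAddCommGroup V]
    [NormedSpace ℝ V] {h : E × ℝ → V} (hh : ContDiff ℝ ∞ h) :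
    ContDiff ℝ ∞ (fun x => ∫ t in (0 : ℝ)..1, h (x, t)) := by
  rw [contDiff_infty]
  intro n
  induction n generalizing V with
  | zero =>
    refine contDiff_zero.2 ?_
    exact intervalIntegral.continuous_parametric_intervalIntegral_of_continuous'
      (f := fun x t => h (x, t)) hh.continuous 0 1
  | succ n ih =>
    have hd := hasFDerivAt_intervalIntegral_of_contDiff (hh.of_le (by simp))
    refine contDiff_succ_iff_hasFDerivAt.2 ⟨_, ?_, hd⟩
    refine ih (h := fun q => (fderiv ℝ h q).comp (ContinuousLinearMap.inl ℝ E ℝ)) ?_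
    exact (hh.fderiv_right (m := ∞) le_rfl).clm_comp contDiff_const

/-- Hadamard's lemma. -/
theorem ContDiff.exists_eq_add_apply_sub {g : E → ℝ} (hg : ContDiff ℝ ∞ g) (x₀ : E) :
    ∃ G : E → E →L[ℝ] ℝ, ContDiff ℝ ∞ G ∧ G x₀ = fderiv ℝ g x₀ ∧
      ∀ x, g x = g x₀ + G x (x - x₀) := by
  have hd : ContDiff ℝ ∞ (fderiv ℝ g) := hg.fderiv_right (m := ∞) le_rfl
  -- `G x` is the mean of the derivative of `g` over the segment from `x₀` to `x`.
  refine ⟨fun x => ∫ t in (0 : ℝ)..1, fderiv ℝ g (x₀ + t • (x - x₀)), ?_, by simp, fun x => ?_⟩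
  · exact contDiff_intervalIntegral (h := fun q : E × ℝ => fderiv ℝ g (x₀ + q.2 • (q.1 - x₀)))
      (hd.comp (by fun_prop))
  · have hc : Continuous fun t : ℝ => fderiv ℝ g (x₀ + t • (x - x₀)) :=
      hd.continuous.comp (by fun_prop)
    rw [ContinuousLinearMap.intervalIntegral_apply (hc.intervalIntegrable _ _)]
    have key : ∀ t ∈ Set.uIcc (0 : ℝ) 1, HasDerivAt (fun t : ℝ => g (x₀ + t • (x - x₀)))
        (fderiv ℝ g (x₀ + t • (x - x₀)) (x - x₀)) t := fun t _ => by
      have h1 : HasDerivAt (fun t : ℝ => x₀ + t • (x - x₀)) (x - x₀) t := by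
        simpa using ((hasDerivAt_id t).smul_const (x - x₀)).const_add x₀
      exact ((hg.differentiable (by simp)) _).hasFDerivAt.comp_hasDerivAt t h1
    rw [intervalIntegral.integral_eq_sub_of_hasDerivAt key
      ((hc.clm_apply continuous_const).intervalIntegrable _ _)]
    simp

end Hadamard

namespace PoissonStructure

/-! ### Algebraic consequences of the bracket axioms. -/

section BracketAlgebra

variable {E : Type*} [NormedAddCommGroup E] [NormedSpace ℝ E]
  {P : Type*} [TopologicalSpace P] [ChartedSpace E P]

variable (S : PoissonStructure E P)

theorem bracket_antisymm (F H : C^∞⟮𝓘(ℝ, E), P; ℝ⟯) : S.bracket F H = - S.bracket H F := by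
  have h := S.bracket_self (F + H)
  simp only [map_add, LinearMap.add_apply, S.bracket_self, zero_add, add_zero] at h
  rw [add_comm] at h
  exact eq_neg_of_add_eq_zero_left (by rw [← h])

theorem bracket_mul_apply (F G H : C^∞⟮𝓘(ℝ, E), P; ℝ⟯) (z : P) :
    S.bracket (F * G) H z = F z * S.bracket G H z + S.bracket F H z * G z := by
  rw [S.leibniz]; rfl

theorem bracket_one (H : C^∞⟮𝓘(ℝ, E), P; ℝ⟯) : S.bracket 1 H = 0 := by
  have h := S.leibniz 1 1 H
  simpa using h

/-- The bracket with `H`, evaluated at `z`, as a linear functional of the first argument. -/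
noncomputable def bracketEval (H : C^∞⟮𝓘(ℝ, E), P; ℝ⟯) (z : P) :
    C^∞⟮𝓘(ℝ, E), P; ℝ⟯ →ₗ[ℝ] ℝ where
  toFun F := S.bracket F H z
  map_add' F G := by rw [map_add]; rfl
  map_smul' c F := by rw [map_smul]; rfl

theorem bracketEval_apply (F H : C^∞⟮𝓘(ℝ, E), P; ℝ⟯) (z : P) :
    S.bracketEval H z F = S.bracket F H z := rfl

end BracketAlgebra

/-! ### Locality of the bracket: it depends only on differentials. -/

section LocalTheory

variable {E : Type*} [NormedAddCommGroup E] [NormedSpace ℝ E] [FiniteDimensional ℝ E]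
  {P : Type*} [TopologicalSpace P] [ChartedSpace E P] [IsManifold 𝓘(ℝ, E) ∞ P] [T2Space P]

/-- The smooth function on `P` that agrees near `p` with `g` read in the chart at `p`. -/
noncomputable def chartExtend {p : P} (χ : SmoothBumpFunction 𝓘(ℝ, E) p) (g : E → ℝ)
    (hg : ContDiff ℝ ∞ g) : C^∞⟮𝓘(ℝ, E), P; ℝ⟯ :=
  ⟨fun z => χ z • g (extChartAt 𝓘(ℝ, E) p z), χ.contMDiff_smul
    (g := fun z => g (extChartAt 𝓘(ℝ, E) p z))
    (hg.contMDiff.comp_contMDiffOn (contMDiffOn_extChartAt))⟩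

theorem chartExtend_apply {p : P} (χ : SmoothBumpFunction 𝓘(ℝ, E) p) (g : E → ℝ)
    (hg : ContDiff ℝ ∞ g) (z : P) :
    chartExtend χ g hg z = χ z * g (extChartAt 𝓘(ℝ, E) p z) := rfl

variable (S : PoissonStructure E P)

/-- Take a bump `χ` that is nonzero only where `F` vanishes. Then `F χ = 0`, and the Leibniz rule at
`z`, with `F z = 0` and `χ z = 1`, leaves exactly `{F, H}(z)`. -/
theorem bracket_apply_eq_zero_of_eventuallyEq {F : C^∞⟮𝓘(ℝ, E), P; ℝ⟯} {z : P}
    (hF : F =ᶠ[𝓝 z] 0) (H : C^∞⟮𝓘(ℝ, E), P; ℝ⟯) : S.bracket F H z = 0 := by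
  obtain ⟨χ, -, hχ⟩ := (SmoothBumpFunction.nhds_basis_support (I := 𝓘(ℝ, E)) hF).mem_iff.1 hF
  have h : F * chartExtend χ (fun _ => 1) contDiff_const = 0 := by
    ext w
    change F w * (χ w * 1) = 0
    by_cases hw : w ∈ Function.support χ
    · rw [show F w = 0 from hχ hw, zero_mul]
    · rw [Function.notMem_support.1 hw]; simp
  have h2 := S.bracket_mul_apply F (chartExtend χ (fun _ => 1) contDiff_const) H z
  rw [h, map_zero, chartExtend_apply, χ.eq_one, show F z = 0 from hF.self_of_nhds] at h2
  simpa using h2.symm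

theorem bracket_apply_congr {F G : C^∞⟮𝓘(ℝ, E), P; ℝ⟯} {z : P}
    (h : F =ᶠ[𝓝 z] G) (H : C^∞⟮𝓘(ℝ, E), P; ℝ⟯) : S.bracket F H z = S.bracket G H z := by
  have := S.bracket_apply_eq_zero_of_eventuallyEq (F := F - G) (z := z)
    (by filter_upwards [h] with w hw; exact sub_eq_zero.2 hw) H
  rw [← bracketEval_apply, map_sub] at this
  exact sub_eq_zero.1 this

/-- A real function on `P`, read in the chart at `p`. -/
noncomputable def chartRep (p : P) (F : C^∞⟮𝓘(ℝ, E), P; ℝ⟯) : E → ℝ :=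
  fun y => F ((extChartAt 𝓘(ℝ, E) p).symm y)

theorem contDiffOn_chartRep (p : P) (F : C^∞⟮𝓘(ℝ, E), P; ℝ⟯) :
    ContDiffOn ℝ ∞ (chartRep p F) (extChartAt 𝓘(ℝ, E) p).target :=
  (F.contMDiff.comp_contMDiffOn (contMDiffOn_extChartAt_symm p)).contDiffOn

theorem contDiffAt_chartRep {p : P} (F : C^∞⟮𝓘(ℝ, E), P; ℝ⟯) {y : E}
    (hy : y ∈ (extChartAt 𝓘(ℝ, E) p).target) : ContDiffAt ℝ ∞ (chartRep p F) y :=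
  (contDiffOn_chartRep p F).contDiffAt ((isOpen_extChartAt_target p).mem_nhds hy)

theorem mfderiv_eq_fderiv_chartRep {p z : P} (hz : z ∈ (extChartAt 𝓘(ℝ, E) p).source)
    (F : C^∞⟮𝓘(ℝ, E), P; ℝ⟯) (v : TangentSpace 𝓘(ℝ, E) z) :
    (mfderiv 𝓘(ℝ, E) 𝓘(ℝ, ℝ) F z v : ℝ) =
      fderiv ℝ (chartRep p F) (extChartAt 𝓘(ℝ, E) p z)
        (mfderiv 𝓘(ℝ, E) 𝓘(ℝ, E) (extChartAt 𝓘(ℝ, E) p) z v) := by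
  have h : F =ᶠ[𝓝 z] chartRep p F ∘ extChartAt 𝓘(ℝ, E) p := by
    filter_upwards [(isOpen_extChartAt_source p).mem_nhds hz] with w hw
    simp only [chartRep, Function.comp_apply, (extChartAt 𝓘(ℝ, E) p).left_inv hw]
  have hd := (contDiffAt_chartRep F ((extChartAt 𝓘(ℝ, E) p).map_source hz)).differentiableAt
    (by simp)
  rw [h.mfderiv_eq, mfderiv_comp z hd.mdifferentiableAt
    (mdifferentiableAt_extChartAt (by simpa using hz)), mfderiv_eq_fderiv]
  rfl

/-- The coordinate functionals of a fixed basis of `E`. -/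
noncomputable def coordCLM (E : Type*) [NormedAddCommGroup E] [NormedSpace ℝ E]
    [FiniteDimensional ℝ E] (i : Fin (Module.finrank ℝ E)) : E →L[ℝ] ℝ :=
  LinearMap.toContinuousLinearMap ((Module.finBasis ℝ E).coord i)

theorem sum_coordCLM_smul (v : E) :
    ∑ i, coordCLM E i v • Module.finBasis ℝ E i = v :=
  (Module.finBasis ℝ E).sum_repr v

theorem coordCLM_finBasis (i j : Fin (Module.finrank ℝ E)) :
    coordCLM E i (Module.finBasis ℝ E j) = if i = j then 1 else 0 := by
  simp [coordCLM, Finsupp.single_apply, eq_comm]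

theorem contMDiffMap_sum_apply {ι : Type*} (s : Finset ι) (f : ι → C^∞⟮𝓘(ℝ, E), P; ℝ⟯) (z : P) :
    (∑ i ∈ s, f i : C^∞⟮𝓘(ℝ, E), P; ℝ⟯) z = ∑ i ∈ s, f i z :=
  map_sum (⟨⟨fun F : C^∞⟮𝓘(ℝ, E), P; ℝ⟯ => F z, rfl⟩, fun _ _ => rfl⟩ :
        C^∞⟮𝓘(ℝ, E), P; ℝ⟯ →+ ℝ) f s

/-- By Hadamard's lemma `F` is, near `z`, a constant plus a sum of products `aᵢ bᵢ` whose factors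
both vanish at `z`. Leibniz kills each product and constants have zero bracket. -/
theorem bracket_apply_eq_zero_of_fderiv {z : P} {F : C^∞⟮𝓘(ℝ, E), P; ℝ⟯}
    (hF : fderiv ℝ (chartRep z F) (extChartAt 𝓘(ℝ, E) z z) = 0) (H : C^∞⟮𝓘(ℝ, E), P; ℝ⟯) :
    S.bracket F H z = 0 := by
  obtain ⟨χ⟩ : Nonempty (SmoothBumpFunction 𝓘(ℝ, E) z) := inferInstance
  set φ := extChartAt 𝓘(ℝ, E) z with hφ
  -- The cutoff makes the chart expression smooth on all of `E`, as Hadamard's lemma requires.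
  let g : E → ℝ := fun y => χ.toContDiffBump y * chartRep z F y
  have hsub : Metric.closedBall (φ z) χ.rOut ⊆ φ.target := by
    have := χ.closedBall_subset
    rwa [ModelWithCorners.range_eq_univ, Set.inter_univ] at this
  have hg : ContDiff ℝ ∞ g := by
    refine contMDiff_iff_contDiff.1 (contMDiff_of_tsupport fun y hy => ?_)
    have hy' : y ∈ φ.target :=
      hsub (χ.toContDiffBump.tsupport_eq ▸ tsupport_mul_subset_left hy)
    exact (χ.toContDiffBump.contDiff.contDiffAt.mul (contDiffAt_chartRep F hy')).contMDiffAt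
  have hgr : g =ᶠ[𝓝 (φ z)] chartRep z F := by
    filter_upwards [χ.toContDiffBump.eventuallyEq_one] with y hy
    simp only [g]
    rw [hy, Pi.one_apply, one_mul]
  obtain ⟨G, hG, hG0, hGx⟩ := hg.exists_eq_add_apply_sub (φ z)
  have hG0' : G (φ z) = 0 := by rw [hG0, hgr.fderiv_eq, hF]
  have ha : ∀ i, ContDiff ℝ ∞ fun y => coordCLM E i (y - φ z) := fun i => by fun_prop
  have hb : ∀ i, ContDiff ℝ ∞ fun y => G y (Module.finBasis ℝ E i) := fun i => by fun_prop
  have hFe : F =ᶠ[𝓝 z] (g (φ z) • (1 : C^∞⟮𝓘(ℝ, E), P; ℝ⟯) +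
      ∑ i, chartExtend χ _ (ha i) * chartExtend χ _ (hb i) : C^∞⟮𝓘(ℝ, E), P; ℝ⟯) := by
    filter_upwards [χ.eventuallyEq_one, extChartAt_source_mem_nhds (I := 𝓘(ℝ, E)) z,
      (continuousAt_extChartAt z).eventually hgr] with w hw hws hwg
    have h1 : F w = g (φ w) := by
      rw [hwg, chartRep, φ.left_inv hws]
    rw [h1, hGx (φ w)]
    conv_lhs => rw [← sum_coordCLM_smul (φ w - φ z)]
    change _ = g (φ z) * 1 + (∑ i, chartExtend χ _ (ha i) * chartExtend χ _ (hb i) :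
      C^∞⟮𝓘(ℝ, E), P; ℝ⟯) w
    rw [contMDiffMap_sum_apply, mul_one, map_sum]
    congr 1
    refine Finset.sum_congr rfl fun i _ => ?_
    change _ = chartExtend χ _ (ha i) w * chartExtend χ _ (hb i) w
    rw [chartExtend_apply, chartExtend_apply, hw, map_smul]
    simp [hφ]
  rw [S.bracket_apply_congr hFe, ← bracketEval_apply, map_add, map_smul, map_sum,
    bracketEval_apply, bracket_one]
  simp only [bracketEval_apply, bracket_mul_apply, chartExtend_apply, ← hφ, hG0', sub_self]
  simp

/-- Vanishing of the differential does not depend on the chart, whose derivative is invertible. A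
single chart thus serves all nearby points, which is needed to differentiate the tensor. -/
theorem bracket_apply_eq_zero_of_fderiv_chartRep {p z : P}
    (hz : z ∈ (extChartAt 𝓘(ℝ, E) p).source) {F : C^∞⟮𝓘(ℝ, E), P; ℝ⟯}
    (hF : fderiv ℝ (chartRep p F) (extChartAt 𝓘(ℝ, E) p z) = 0) (H : C^∞⟮𝓘(ℝ, E), P; ℝ⟯) :
    S.bracket F H z = 0 := by
  refine S.bracket_apply_eq_zero_of_fderiv ?_ H
  have hzz := mem_extChartAt_source (I := 𝓘(ℝ, E)) z
  obtain ⟨e, he⟩ := isInvertible_mfderiv_extChartAt (I := 𝓘(ℝ, E)) hzz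
  have key : ∀ w, fderiv ℝ (chartRep z F) (extChartAt 𝓘(ℝ, E) z z)
      (mfderiv 𝓘(ℝ, E) 𝓘(ℝ, E) (extChartAt 𝓘(ℝ, E) z) z w) = 0 := fun w => by
    rw [← mfderiv_eq_fderiv_chartRep hzz F w, mfderiv_eq_fderiv_chartRep hz, hF]
    rfl
  refine ContinuousLinearMap.ext fun v => ?_
  have h2 := key (e.symm v)
  rw [← he] at h2
  have h3 : e (e.symm v) = v := e.apply_symm_apply v
  exact (congrArg _ h3).symm.trans h2

end LocalTheory

end PoissonStructure

namespace PoissonStructure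

/-! ### The Poisson tensor in a chart and its invariance. -/

section CoordinateForm

variable {E : Type*} [NormedAddCommGroup E] [NormedSpace ℝ E] [FiniteDimensional ℝ E]
  {P : Type*} [TopologicalSpace P] [ChartedSpace E P] [IsManifold 𝓘(ℝ, E) ∞ P] [T2Space P]

/-- Points of the chart domain near which the bump function equals one. -/
def bumpOneSet {p : P} (χ : SmoothBumpFunction 𝓘(ℝ, E) p) : Set P :=
  {z | z ∈ (extChartAt 𝓘(ℝ, E) p).source ∧ χ =ᶠ[𝓝 z] 1}

theorem isOpen_bumpOneSet {p : P} (χ : SmoothBumpFunction 𝓘(ℝ, E) p) :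
    IsOpen (bumpOneSet χ) :=
  (isOpen_extChartAt_source p).inter isOpen_setOfPred_eventually_nhds

theorem mem_bumpOneSet {p : P} (χ : SmoothBumpFunction 𝓘(ℝ, E) p) : p ∈ bumpOneSet χ :=
  ⟨mem_extChartAt_source p, χ.eventuallyEq_one⟩

theorem symm_eventually_mem_bumpOneSet {p : P} (χ : SmoothBumpFunction 𝓘(ℝ, E) p) {z : P}
    (hz : z ∈ bumpOneSet χ) : ∀ᶠ y in 𝓝 (extChartAt 𝓘(ℝ, E) p z),
      y ∈ (extChartAt 𝓘(ℝ, E) p).target ∧ (extChartAt 𝓘(ℝ, E) p).symm y ∈ bumpOneSet χ := by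
  refine ((isOpen_extChartAt_target p).eventually_mem
    ((extChartAt 𝓘(ℝ, E) p).map_source hz.1)).and ?_
  have h := (continuousAt_extChartAt_symm' (I := 𝓘(ℝ, E)) hz.1)
  refine h.eventually_mem ?_
  rw [(extChartAt 𝓘(ℝ, E) p).left_inv hz.1]
  exact (isOpen_bumpOneSet χ).mem_nhds hz

/-- The smooth function on `P` that agrees near `p` with a linear functional in the chart. -/
noncomputable def coordFn {p : P} (χ : SmoothBumpFunction 𝓘(ℝ, E) p) (α : E →L[ℝ] ℝ) :
    C^∞⟮𝓘(ℝ, E), P; ℝ⟯ := chartExtend χ α α.contDiff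

theorem chartRep_coordFn {p : P} (χ : SmoothBumpFunction 𝓘(ℝ, E) p) (α : E →L[ℝ] ℝ) {z : P}
    (hz : z ∈ bumpOneSet χ) :
    chartRep p (coordFn χ α) =ᶠ[𝓝 (extChartAt 𝓘(ℝ, E) p z)] α := by
  filter_upwards [symm_eventually_mem_bumpOneSet χ hz] with y hy
  rw [chartRep, coordFn, chartExtend_apply, hy.2.2.self_of_nhds,
    (extChartAt 𝓘(ℝ, E) p).right_inv hy.1, Pi.one_apply, one_mul]

theorem fderiv_chartRep_coordFn {p : P} (χ : SmoothBumpFunction 𝓘(ℝ, E) p) (α : E →L[ℝ] ℝ)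
    {z : P} (hz : z ∈ bumpOneSet χ) :
    fderiv ℝ (chartRep p (coordFn χ α)) (extChartAt 𝓘(ℝ, E) p z) = α := by
  rw [(chartRep_coordFn χ α hz).fderiv_eq, α.fderiv]

theorem coordFn_eq_sum {p : P} (χ : SmoothBumpFunction 𝓘(ℝ, E) p) (α : E →L[ℝ] ℝ) :
    coordFn χ α = ∑ i, α (Module.finBasis ℝ E i) • coordFn χ (coordCLM E i) := by
  ext z
  rw [contMDiffMap_sum_apply]
  change χ z * α (extChartAt 𝓘(ℝ, E) p z) = ∑ i, α (Module.finBasis ℝ E i) *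
    (χ z * coordCLM E i (extChartAt 𝓘(ℝ, E) p z))
  conv_lhs => rw [← sum_coordCLM_smul (extChartAt 𝓘(ℝ, E) p z)]
  rw [map_sum, Finset.mul_sum]
  refine Finset.sum_congr rfl fun i _ => ?_
  rw [map_smul, smul_eq_mul]
  ring

variable (S : PoissonStructure E P)

/-- The Hamiltonian vector field of `H` in the chart at `p`. -/
noncomputable def hamCoord {p : P} (χ : SmoothBumpFunction 𝓘(ℝ, E) p)
    (H : C^∞⟮𝓘(ℝ, E), P; ℝ⟯) (z : P) : E :=
  ∑ i, S.bracket (coordFn χ (coordCLM E i)) H z • Module.finBasis ℝ E i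

theorem coordCLM_sum_smul (c : Fin (Module.finrank ℝ E) → ℝ) (i : Fin (Module.finrank ℝ E)) :
    coordCLM E i (∑ j, c j • Module.finBasis ℝ E j) = c i := by
  simp [coordCLM_finBasis]

theorem coordCLM_hamCoord {p : P} (χ : SmoothBumpFunction 𝓘(ℝ, E) p)
    (H : C^∞⟮𝓘(ℝ, E), P; ℝ⟯) (z : P) (i : Fin (Module.finrank ℝ E)) :
    coordCLM E i (S.hamCoord χ H z) = S.bracket (coordFn χ (coordCLM E i)) H z :=
  coordCLM_sum_smul _ i

theorem ext_coordCLM {v w : E} (h : ∀ i, coordCLM E i v = coordCLM E i w) : v = w := by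
  rw [← sum_coordCLM_smul v, ← sum_coordCLM_smul w]
  simp only [h]

theorem chartRep_sub (p : P) (F G : C^∞⟮𝓘(ℝ, E), P; ℝ⟯) :
    chartRep p (F - G) = chartRep p F - chartRep p G := rfl

/-- `F` and the coordinate function of its differential at `z` have the same differential there,
hence the same bracket with `H`; the latter function is a linear combination of coordinates. -/
theorem bracket_eq_fderiv {p z : P} (χ : SmoothBumpFunction 𝓘(ℝ, E) p) (hz : z ∈ bumpOneSet χ)
    (F H : C^∞⟮𝓘(ℝ, E), P; ℝ⟯) :
    S.bracket F H z =
      fderiv ℝ (chartRep p F) (extChartAt 𝓘(ℝ, E) p z) (S.hamCoord χ H z) := by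
  set α := fderiv ℝ (chartRep p F) (extChartAt 𝓘(ℝ, E) p z) with hα
  have ht := (extChartAt 𝓘(ℝ, E) p).map_source hz.1
  have h0 : S.bracketEval H z (F - coordFn χ α) = 0 := by
    refine S.bracket_apply_eq_zero_of_fderiv_chartRep hz.1 ?_ H
    rw [chartRep_sub, fderiv_sub ((contDiffAt_chartRep F ht).differentiableAt (by simp))
      ((contDiffAt_chartRep _ ht).differentiableAt (by simp)), fderiv_chartRep_coordFn χ α hz,
      ← hα, sub_self]
  rw [map_sub, sub_eq_zero, coordFn_eq_sum, map_sum] at h0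
  rw [← bracketEval_apply, h0, hamCoord, map_sum]
  refine Finset.sum_congr rfl fun i _ => ?_
  rw [map_smul, map_smul, bracketEval_apply, smul_eq_mul, smul_eq_mul, mul_comm]

/-- The Poisson tensor in the chart at `p`, as a map from covectors to vectors. -/
noncomputable def poissonTensor {p : P} (χ : SmoothBumpFunction 𝓘(ℝ, E) p) (z : P) :
    (E →L[ℝ] ℝ) →L[ℝ] E :=
  ∑ i, ∑ j, S.bracket (coordFn χ (coordCLM E i)) (coordFn χ (coordCLM E j)) z •
    (ContinuousLinearMap.apply ℝ ℝ (Module.finBasis ℝ E j)).smulRight (Module.finBasis ℝ E i)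

theorem coordCLM_poissonTensor {p : P} (χ : SmoothBumpFunction 𝓘(ℝ, E) p) (z : P)
    (β : E →L[ℝ] ℝ) (i : Fin (Module.finrank ℝ E)) :
    coordCLM E i (S.poissonTensor χ z β) =
      ∑ j, S.bracket (coordFn χ (coordCLM E i)) (coordFn χ (coordCLM E j)) z *
        β (Module.finBasis ℝ E j) := by
  have h : S.poissonTensor χ z β =
      ∑ i, (∑ j, S.bracket (coordFn χ (coordCLM E i)) (coordFn χ (coordCLM E j)) z *
        β (Module.finBasis ℝ E j)) • Module.finBasis ℝ E i := by
    simp [poissonTensor, Finset.sum_smul, smul_smul]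
  rw [h, coordCLM_sum_smul]

theorem poissonTensor_coordCLM {p : P} (χ : SmoothBumpFunction 𝓘(ℝ, E) p) (z : P)
    (i : Fin (Module.finrank ℝ E)) :
    S.poissonTensor χ z (coordCLM E i) = S.hamCoord χ (coordFn χ (coordCLM E i)) z := by
  refine ext_coordCLM fun k => ?_
  rw [coordCLM_poissonTensor, coordCLM_hamCoord]
  simp [coordCLM_finBasis]

theorem hamCoord_eq_poissonTensor {p z : P} (χ : SmoothBumpFunction 𝓘(ℝ, E) p)
    (hz : z ∈ bumpOneSet χ) (H : C^∞⟮𝓘(ℝ, E), P; ℝ⟯) :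
    S.hamCoord χ H z =
      S.poissonTensor χ z (fderiv ℝ (chartRep p H) (extChartAt 𝓘(ℝ, E) p z)) := by
  refine ext_coordCLM fun i => ?_
  rw [coordCLM_hamCoord, coordCLM_poissonTensor, S.bracket_antisymm]
  change -(S.bracket H _ z) = _
  rw [S.bracket_eq_fderiv χ hz, hamCoord, map_sum, ← Finset.sum_neg_distrib]
  refine Finset.sum_congr rfl fun j _ => ?_
  rw [S.bracket_antisymm (coordFn χ (coordCLM E i)), map_smul, smul_eq_mul]
  change _ = -(S.bracket _ _ z) * _
  ring

/-- Coordinate functions suffice as test functions. Since the chart differential is invertible, the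
Hamiltonian vector exists and is unique. -/
theorem isHamiltonianVector_iff {p z : P} (χ : SmoothBumpFunction 𝓘(ℝ, E) p)
    (hz : z ∈ bumpOneSet χ) (H : C^∞⟮𝓘(ℝ, E), P; ℝ⟯) (v : TangentSpace 𝓘(ℝ, E) z) :
    S.IsHamiltonianVector H z v ↔
      mfderiv 𝓘(ℝ, E) 𝓘(ℝ, E) (extChartAt 𝓘(ℝ, E) p) z v = S.hamCoord χ H z := by
  refine ⟨fun h => ext_coordCLM (E := E) fun i => ?_, fun h F => ?_⟩
  · have h1 := h (coordFn χ (coordCLM E i))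
    rw [mfderiv_eq_fderiv_chartRep hz.1, fderiv_chartRep_coordFn χ _ hz] at h1
    rw [coordCLM_hamCoord]
    exact h1
  · rw [mfderiv_eq_fderiv_chartRep hz.1, S.bracket_eq_fderiv χ hz]
    exact congrArg _ h

/-- The chart differential carries the characteristic space onto the range of the tensor, because
every covector is the differential of some `coordFn`. -/
theorem finrank_characteristicSpace {p z : P} (χ : SmoothBumpFunction 𝓘(ℝ, E) p)
    (hz : z ∈ bumpOneSet χ) : Module.finrank ℝ (S.characteristicSpace z) =
      Module.finrank ℝ (LinearMap.range (S.poissonTensor χ z : (E →L[ℝ] ℝ) →ₗ[ℝ] E)) := by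
  obtain ⟨e, he⟩ := isInvertible_mfderiv_extChartAt (I := 𝓘(ℝ, E)) hz.1
  have h : (S.characteristicSpace z).map e.toLinearEquiv.toLinearMap =
      LinearMap.range (S.poissonTensor χ z : (E →L[ℝ] ℝ) →ₗ[ℝ] E) := by
    ext w
    constructor
    · rintro ⟨v, ⟨H, hH⟩, rfl⟩
      rw [S.isHamiltonianVector_iff χ hz, ← he] at hH
      exact ⟨_, ((S.hamCoord_eq_poissonTensor χ hz H).symm.trans hH.symm)⟩
    · rintro ⟨β, rfl⟩
      refine ⟨e.symm (S.poissonTensor χ z β), ⟨coordFn χ β, ?_⟩, e.apply_symm_apply _⟩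
      rw [S.isHamiltonianVector_iff χ hz, ← he, S.hamCoord_eq_poissonTensor χ hz,
        fderiv_chartRep_coordFn χ β hz]
      exact e.apply_symm_apply _
  rw [← h]
  exact (LinearEquiv.finrank_map_eq e.toLinearEquiv (S.characteristicSpace z)).symm

theorem continuous_poissonTensor {p : P} (χ : SmoothBumpFunction 𝓘(ℝ, E) p) :
    Continuous (S.poissonTensor χ) :=
  continuous_finsetSum _ fun _ _ => continuous_finsetSum _ fun _ _ =>
    (S.bracket _ _).contMDiff.continuous.smul continuous_const

theorem contDiffAt_hamCoord {p : P} (χ : SmoothBumpFunction 𝓘(ℝ, E) p)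
    (H : C^∞⟮𝓘(ℝ, E), P; ℝ⟯) {y : E} (hy : y ∈ (extChartAt 𝓘(ℝ, E) p).target) :
    ContDiffAt ℝ ∞ (fun y => S.hamCoord χ H ((extChartAt 𝓘(ℝ, E) p).symm y)) y :=
  ContDiffAt.sum fun _ _ => (contDiffAt_chartRep _ hy).smul contDiffAt_const

theorem contDiffAt_poissonTensor {p : P} (χ : SmoothBumpFunction 𝓘(ℝ, E) p)
    {y : E} (hy : y ∈ (extChartAt 𝓘(ℝ, E) p).target) :
    ContDiffAt ℝ ∞ (fun y => S.poissonTensor χ ((extChartAt 𝓘(ℝ, E) p).symm y)) y :=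
  ContDiffAt.sum fun _ _ => ContDiffAt.sum fun _ _ =>
    (contDiffAt_chartRep _ hy).smul contDiffAt_const

/-- The Jacobi identity in derivation form, the source of the invariance in `fderiv_poissonTensor`.
-/
theorem bracket_bracket (F G H : C^∞⟮𝓘(ℝ, E), P; ℝ⟯) :
    S.bracket (S.bracket F G) H = S.bracket (S.bracket F H) G + S.bracket F (S.bracket G H) := by
  have h := S.jacobi F G H
  rw [S.bracket_antisymm H F, map_neg, S.bracket_antisymm G (S.bracket F H), neg_neg,
    S.bracket_antisymm H (S.bracket F G)] at h
  rw [← sub_eq_zero, ← neg_eq_zero, ← h]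
  abel

/-- Precomposition with an endomorphism, acting on covectors. -/
noncomputable def dualComp : (E →L[ℝ] E) →L[ℝ] (E →L[ℝ] ℝ) →L[ℝ] (E →L[ℝ] ℝ) :=
  (ContinuousLinearMap.compL ℝ E E ℝ).flip

theorem dualComp_apply (A : E →L[ℝ] E) (β : E →L[ℝ] ℝ) : dualComp A β = β.comp A := rfl

theorem ext_dual {T T' : (E →L[ℝ] ℝ) →L[ℝ] E}
    (h : ∀ i j, coordCLM E i (T (coordCLM E j)) = coordCLM E i (T' (coordCLM E j))) : T = T' := by
  ext β
  have hβ : β = ∑ j, β (Module.finBasis ℝ E j) • coordCLM E j := by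
    ext v
    conv_lhs => rw [← sum_coordCLM_smul v]
    simp [mul_comm]
  refine ext_coordCLM fun i => ?_
  rw [hβ]
  simp only [map_sum, map_smul, h]

/-- The Poisson tensor is transported by a Hamiltonian vector field. -/
theorem fderiv_poissonTensor {p z : P} (χ : SmoothBumpFunction 𝓘(ℝ, E) p)
    (hz : z ∈ bumpOneSet χ) (H : C^∞⟮𝓘(ℝ, E), P; ℝ⟯) :
    fderiv ℝ (fun y => S.poissonTensor χ ((extChartAt 𝓘(ℝ, E) p).symm y))
        (extChartAt 𝓘(ℝ, E) p z) (S.hamCoord χ H z) =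
      (fderiv ℝ (fun y => S.hamCoord χ H ((extChartAt 𝓘(ℝ, E) p).symm y))
        (extChartAt 𝓘(ℝ, E) p z)).comp (S.poissonTensor χ z) +
      (S.poissonTensor χ z).comp (dualComp
        (fderiv ℝ (fun y => S.hamCoord χ H ((extChartAt 𝓘(ℝ, E) p).symm y))
          (extChartAt 𝓘(ℝ, E) p z))) := by
  have ht := (extChartAt 𝓘(ℝ, E) p).map_source hz.1
  have hf : ∀ i w, coordCLM E i
      (fderiv ℝ (fun y => S.hamCoord χ H ((extChartAt 𝓘(ℝ, E) p).symm y))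
        (extChartAt 𝓘(ℝ, E) p z) w) =
      fderiv ℝ (chartRep p (S.bracket (coordFn χ (coordCLM E i)) H))
        (extChartAt 𝓘(ℝ, E) p z) w := fun i w => by
    have h1 := (coordCLM E i).hasFDerivAt.comp _
      ((S.contDiffAt_hamCoord χ H ht).differentiableAt (by simp)).hasFDerivAt
    have h2 : coordCLM E i ∘ (fun y => S.hamCoord χ H ((extChartAt 𝓘(ℝ, E) p).symm y)) =
        chartRep p (S.bracket (coordFn χ (coordCLM E i)) H) :=
      funext fun y => S.coordCLM_hamCoord χ H _ i
    rw [h2] at h1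
    rw [h1.fderiv]
    rfl
  have hb : ∀ i j w, coordCLM E i
      (fderiv ℝ (fun y => S.poissonTensor χ ((extChartAt 𝓘(ℝ, E) p).symm y))
        (extChartAt 𝓘(ℝ, E) p z) w (coordCLM E j)) =
      fderiv ℝ (chartRep p (S.bracket (coordFn χ (coordCLM E i)) (coordFn χ (coordCLM E j))))
        (extChartAt 𝓘(ℝ, E) p z) w := fun i j w => by
    have h1 := ((coordCLM E i).comp (ContinuousLinearMap.apply ℝ E (coordCLM E j))).hasFDerivAt.comp
      _ ((S.contDiffAt_poissonTensor χ ht).differentiableAt (by simp)).hasFDerivAt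
    have h2 : ((coordCLM E i).comp (ContinuousLinearMap.apply ℝ E (coordCLM E j))) ∘
        (fun y => S.poissonTensor χ ((extChartAt 𝓘(ℝ, E) p).symm y)) =
        chartRep p (S.bracket (coordFn χ (coordCLM E i)) (coordFn χ (coordCLM E j))) :=
      funext fun y => by
        simp only [Function.comp_apply, ContinuousLinearMap.comp_apply,
          ContinuousLinearMap.apply_apply, poissonTensor_coordCLM, coordCLM_hamCoord]
        rfl
    rw [h2] at h1
    rw [h1.fderiv]
    rfl
  refine ext_dual fun i j => ?_
  -- On a pair of coordinates the claim reads `{{xᵢ,xⱼ},H} = {{xᵢ,H},xⱼ} + {xᵢ,{xⱼ,H}}`.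
  rw [hb, ← S.bracket_eq_fderiv χ hz, bracket_bracket, add_apply (F := (E →L[ℝ] ℝ) →L[ℝ] E),
    map_add, ContinuousLinearMap.comp_apply, ContinuousLinearMap.comp_apply, hf, poissonTensor_coordCLM,
    ← S.bracket_eq_fderiv χ hz, dualComp_apply]
  have h3 : (coordCLM E j).comp
      (fderiv ℝ (fun y => S.hamCoord χ H ((extChartAt 𝓘(ℝ, E) p).symm y))
        (extChartAt 𝓘(ℝ, E) p z)) =
      fderiv ℝ (chartRep p (S.bracket (coordFn χ (coordCLM E j)) H))
        (extChartAt 𝓘(ℝ, E) p z) := ContinuousLinearMap.ext (hf j)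
  rw [h3, ← S.hamCoord_eq_poissonTensor χ hz, coordCLM_hamCoord]
  rfl

end CoordinateForm

end PoissonStructure

/-! ### Ordinary differential equations -/

section ODE

/-- Near `x₀` the field is Lipschitz and both solutions stay there by continuity, so Grönwall
uniqueness applies. Trajectories live on closed intervals and `t₀` may be an endpoint, hence the
one-sided derivatives and the separate forward and backward arguments. -/
theorem ContDiffAt.eventuallyEq_of_hasDerivWithinAt_Icc {V : Type*} [NormedAddCommGroup V]
    [NormedSpace ℝ V] {v : V → V} {x₀ : V} (hv : ContDiffAt ℝ 1 v x₀) {a b t₀ : ℝ}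
    (ht₀ : t₀ ∈ Set.Icc a b) {u w : ℝ → V}
    (hu : ∀ᶠ t in 𝓝[Set.Icc a b] t₀, HasDerivWithinAt u (v (u t)) (Set.Icc a b) t)
    (hw : ∀ᶠ t in 𝓝[Set.Icc a b] t₀, HasDerivWithinAt w (v (w t)) (Set.Icc a b) t)
    (hu₀ : u t₀ = x₀) (hw₀ : w t₀ = x₀) : u =ᶠ[𝓝[Set.Icc a b] t₀] w := by
  obtain ⟨K, s, hs, hl⟩ := hv.exists_lipschitzOnWith
  have hus : ∀ᶠ t in 𝓝[Set.Icc a b] t₀, u t ∈ s :=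
    (hu.self_of_nhdsWithin ht₀).continuousWithinAt.eventually_mem (by rwa [hu₀])
  have hws : ∀ᶠ t in 𝓝[Set.Icc a b] t₀, w t ∈ s :=
    (hw.self_of_nhdsWithin ht₀).continuousWithinAt.eventually_mem (by rwa [hw₀])
  obtain ⟨δ, hδ, hball⟩ := Metric.mem_nhdsWithin_iff.1 (hu.and (hw.and (hus.and hws)))
  refine Metric.mem_nhdsWithin_iff.2 ⟨δ, hδ, fun t ht => ?_⟩
  have h₀ : t₀ ∈ Metric.ball t₀ δ ∩ Set.Icc a b := ⟨Metric.mem_ball_self hδ, ht₀⟩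
  have hconv : (Metric.ball t₀ δ ∩ Set.Icc a b).OrdConnected := by
    rw [Real.ball_eq_Ioo]
    exact Set.ordConnected_Ioo.inter Set.ordConnected_Icc
  rcases le_total t₀ t with h | h
  · have hsub := hconv.out h₀ ht
    have hnhds : ∀ τ ∈ Set.Ico t₀ t, Set.Icc a b ∈ 𝓝[≥] τ := fun τ hτ =>
      Icc_mem_nhdsGE_of_mem ⟨ht₀.1.trans hτ.1, hτ.2.trans_le ht.2.2⟩
    have hmem : ∀ τ ∈ Set.Ico t₀ t, τ ∈ Metric.ball t₀ δ ∩ Set.Icc a b := fun τ hτ =>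
      hsub (Set.Ico_subset_Icc_self hτ)
    exact ODE_solution_unique_of_mem_Icc_right (v := fun _ => v) (s := fun _ => s)
      (fun _ _ => hl)
      (fun τ hτ => ((hball (hsub hτ)).1.continuousWithinAt).mono fun x hx => (hsub hx).2)
      (fun τ hτ => (hball (hmem τ hτ)).1.mono_of_mem_nhdsWithin (hnhds τ hτ))
      (fun τ hτ => (hball (hmem τ hτ)).2.2.1)
      (fun τ hτ => ((hball (hsub hτ)).2.1.continuousWithinAt).mono fun x hx => (hsub hx).2)
      (fun τ hτ => (hball (hmem τ hτ)).2.1.mono_of_mem_nhdsWithin (hnhds τ hτ))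
      (fun τ hτ => (hball (hmem τ hτ)).2.2.2) (hu₀.trans hw₀.symm) (Set.right_mem_Icc.2 h)
  · have hsub := hconv.out ht h₀
    have hnhds : ∀ τ ∈ Set.Ioc t t₀, Set.Icc a b ∈ 𝓝[≤] τ := fun τ hτ =>
      Icc_mem_nhdsLE_of_mem ⟨ht.2.1.trans_lt hτ.1, hτ.2.trans ht₀.2⟩
    have hmem : ∀ τ ∈ Set.Ioc t t₀, τ ∈ Metric.ball t₀ δ ∩ Set.Icc a b := fun τ hτ =>
      hsub (Set.Ioc_subset_Icc_self hτ)
    exact ODE_solution_unique_of_mem_Icc_left (v := fun _ => v) (s := fun _ => s)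
      (fun _ _ => hl)
      (fun τ hτ => ((hball (hsub hτ)).1.continuousWithinAt).mono fun x hx => (hsub hx).2)
      (fun τ hτ => (hball (hmem τ hτ)).1.mono_of_mem_nhdsWithin (hnhds τ hτ))
      (fun τ hτ => (hball (hmem τ hτ)).2.2.1)
      (fun τ hτ => ((hball (hsub hτ)).2.1.continuousWithinAt).mono fun x hx => (hsub hx).2)
      (fun τ hτ => (hball (hmem τ hτ)).2.1.mono_of_mem_nhdsWithin (hnhds τ hτ))
      (fun τ hτ => (hball (hmem τ hτ)).2.2.2) (hu₀.trans hw₀.symm) (Set.left_mem_Icc.2 h)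

/-- A `C¹` vector field has a continuous local flow that stays in a given neighbourhood. -/
theorem ContDiffAt.exists_continuous_localFlow {V : Type*} [NormedAddCommGroup V]
    [NormedSpace ℝ V] [CompleteSpace V] {v : V → V} {x₀ : V} (hv : ContDiffAt ℝ 1 v x₀)
    (t₀ : ℝ) {W : Set V} (hW : W ∈ 𝓝 x₀) :
    ∃ α : V → ℝ → V, ∃ r > 0, ∃ ε > 0,
      (∀ x ∈ Metric.ball x₀ r, α x t₀ = x ∧ ∀ t ∈ Set.Icc (t₀ - ε) (t₀ + ε),
        HasDerivWithinAt (α x) (v (α x t)) (Set.Icc (t₀ - ε) (t₀ + ε)) t ∧ α x t ∈ W) ∧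
      ∀ t ∈ Set.Icc (t₀ - ε) (t₀ + ε), ContinuousAt (fun x => α x t) x₀ := by
  obtain ⟨ε, hε, a, r, L, K, hr, hpl⟩ := IsPicardLindelof.of_contDiffAt_one hv
  obtain ⟨α, hα, hc⟩ := (hpl t₀).exists_forall_mem_closedBall_eq_hasDerivWithinAt_continuousOn
  have hr' : (0 : ℝ) < r := hr
  have hnhds : Metric.closedBall x₀ (r : ℝ) ×ˢ Set.Icc (t₀ - ε) (t₀ + ε) ∈ 𝓝 (x₀, t₀) :=
    prod_mem_nhds (Metric.closedBall_mem_nhds _ hr') (Icc_mem_nhds (by linarith) (by linarith))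
  have hev : ∀ᶠ q in 𝓝 (x₀, t₀), α q ∈ W := by
    refine (hc.continuousAt hnhds).eventually_mem ?_
    rwa [(hα x₀ (Metric.mem_closedBall_self hr'.le)).1]
  obtain ⟨δ, hδ, hball⟩ := Metric.eventually_nhds_iff_ball.1 hev
  -- Halving `δ` puts the closed time interval inside the open ball of radius `δ`.
  have hsub : Set.Icc (t₀ - min ε (δ / 2)) (t₀ + min ε (δ / 2)) ⊆ Set.Icc (t₀ - ε) (t₀ + ε) :=
    Set.Icc_subset_Icc (by linarith [min_le_left ε (δ / 2)]) (by linarith [min_le_left ε (δ / 2)])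
  refine ⟨fun x t => α (x, t), min r δ, lt_min hr' hδ, min ε (δ / 2), lt_min hε (by linarith),
    fun x hx => ?_, fun t ht => ?_⟩
  · have hx1 : x ∈ Metric.closedBall x₀ (r : ℝ) :=
      Metric.ball_subset_closedBall (Metric.ball_subset_ball (min_le_left _ _) hx)
    refine ⟨(hα x hx1).1, fun t ht => ⟨((hα x hx1).2 t (hsub ht)).mono hsub, hball _ ?_⟩⟩
    rw [← ball_prod_same]
    refine ⟨Metric.ball_subset_ball (min_le_right _ _) hx, ?_⟩
    rw [Metric.mem_ball, Real.dist_eq, abs_lt]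
    constructor <;> linarith [ht.1, ht.2, min_le_right ε (δ / 2)]
  · have h1 : ContinuousOn (fun x => α (x, t)) (Metric.closedBall x₀ (r : ℝ)) :=
      hc.comp (by fun_prop) fun x hx => ⟨hx, hsub ht⟩
    exact h1.continuousAt (Metric.closedBall_mem_nhds _ hr')

end ODE

namespace PoissonStructure

/-! ### Constancy of rank for a transported bivector. -/

section RankTransport

variable {E : Type*} [NormedAddCommGroup E] [NormedSpace ℝ E] [FiniteDimensional ℝ E]

/-- The dual of an invertible `Ψ` is onto, so the range of the conjugate is `Ψ` applied to the range
of `T`. -/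
theorem finrank_range_conj {Ψ : E →L[ℝ] E} (hΨ : IsUnit Ψ) (T : (E →L[ℝ] ℝ) →L[ℝ] E) :
    Module.finrank ℝ (LinearMap.range
      ((Ψ.comp (T.comp (dualComp Ψ)) : (E →L[ℝ] ℝ) →L[ℝ] E) : (E →L[ℝ] ℝ) →ₗ[ℝ] E)) =
    Module.finrank ℝ (LinearMap.range (T : (E →L[ℝ] ℝ) →ₗ[ℝ] E)) := by
  obtain ⟨U, rfl⟩ := hΨ
  let e : E ≃L[ℝ] E := ContinuousLinearEquiv.unitsEquiv ℝ E U
  have he : ∀ x, e x = (U : E →L[ℝ] E) x := fun x => rfl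
  have h : LinearMap.range ((((U : E →L[ℝ] E).comp (T.comp (dualComp (U : E →L[ℝ] E)))) :
      (E →L[ℝ] ℝ) →L[ℝ] E) : (E →L[ℝ] ℝ) →ₗ[ℝ] E) =
      (LinearMap.range (T : (E →L[ℝ] ℝ) →ₗ[ℝ] E)).map e.toLinearEquiv.toLinearMap := by
    ext x
    constructor
    · rintro ⟨β, rfl⟩
      exact ⟨T (dualComp U.val β), ⟨_, rfl⟩, rfl⟩
    · rintro ⟨_, ⟨β, rfl⟩, rfl⟩
      refine ⟨β.comp (e.symm : E →L[ℝ] E), ?_⟩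
      have h1 : dualComp (U : E →L[ℝ] E) (β.comp (e.symm : E →L[ℝ] E)) = β := by
        ext x
        rw [dualComp_apply]
        exact congrArg β (e.symm_apply_apply x)
      change (U : E →L[ℝ] E) (T (dualComp (U : E →L[ℝ] E) (β.comp (e.symm : E →L[ℝ] E)))) = _
      rw [h1]
      rfl
  rw [h]
  exact LinearEquiv.finrank_map_eq e.toLinearEquiv _

/-- A bivector field that is transported by a vector field has locally constant rank along the
trajectories. -/
theorem eventually_finrank_range_eq {f : E → E} {B : E → (E →L[ℝ] ℝ) →L[ℝ] E} {x₀ : E}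
    (hf : ContDiffAt ℝ ∞ f x₀)
    (hB : ∀ᶠ y in 𝓝 x₀, DifferentiableAt ℝ B y ∧ fderiv ℝ B y (f y) =
      (fderiv ℝ f y).comp (B y) + (B y).comp (dualComp (fderiv ℝ f y)))
    {a b t₀ : ℝ} (ht₀ : t₀ ∈ Set.Icc a b) {u : ℝ → E}
    (hu : ∀ᶠ t in 𝓝[Set.Icc a b] t₀, HasDerivWithinAt u (f (u t)) (Set.Icc a b) t)
    (hu₀ : u t₀ = x₀) : ∀ᶠ t in 𝓝[Set.Icc a b] t₀,
      Module.finrank ℝ (LinearMap.range (B (u t) : (E →L[ℝ] ℝ) →ₗ[ℝ] E)) =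
        Module.finrank ℝ (LinearMap.range (B x₀ : (E →L[ℝ] ℝ) →ₗ[ℝ] E)) := by
  have : CompleteSpace E := FiniteDimensional.complete ℝ E
  have hf' : ContDiffAt ℝ ∞ (fderiv ℝ f) x₀ := hf.fderiv_right (m := ∞) le_rfl
  have hf1 : ContDiffAt ℝ 1 f x₀ := hf.of_le (by simp)
  have hf1' : ContDiffAt ℝ 1 (fderiv ℝ f) x₀ := hf'.of_le (by simp)
  -- The flow of `f` together with its linearization `Ψ' = Df Ψ`, started at the identity.
  have hv1 : ContDiffAt ℝ 1 (fun q : E × (E →L[ℝ] E) => (f q.1, (fderiv ℝ f q.1).comp q.2))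
      (x₀, ContinuousLinearMap.id ℝ E) :=
    (hf1.comp (x₀, ContinuousLinearMap.id ℝ E) contDiffAt_fst).prodMk
      ((hf1'.comp (x₀, ContinuousLinearMap.id ℝ E) contDiffAt_fst).clm_comp contDiffAt_snd)
  -- The transport equation `T' = Df T + T Dfᵀ`. By the product rule `Ψ B(x₀) Ψᵀ` solves it, and by
  -- hypothesis so does `B` along `u`; uniqueness identifies the two.
  have hv2 : ContDiffAt ℝ 1 (fun q : E × ((E →L[ℝ] ℝ) →L[ℝ] E) =>
      (f q.1, (fderiv ℝ f q.1).comp q.2 + q.2.comp (dualComp (fderiv ℝ f q.1))))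
      (x₀, B x₀) := by
    have h1 : ContDiffAt ℝ 1 (fun q : E × ((E →L[ℝ] ℝ) →L[ℝ] E) => fderiv ℝ f q.1)
        (x₀, B x₀) := hf1'.comp (x₀, B x₀) contDiffAt_fst
    exact (hf1.comp (x₀, B x₀) contDiffAt_fst).prodMk
      ((h1.clm_comp contDiffAt_snd).add
        (contDiffAt_snd.clm_comp
        ((dualComp (E := E)).contDiff.contDiffAt.comp (x₀, B x₀) h1)))
  obtain ⟨η, hη0, ε, hε, hη⟩ :=
    hv1.exists_forall_mem_closedBall_exists_eq_forall_mem_Ioo_hasDerivAt₀ t₀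
  have hη' : ∀ᶠ t in 𝓝 t₀, HasDerivAt η
      (f (η t).1, (fderiv ℝ f (η t).1).comp (η t).2) t := by
    filter_upwards [Ioo_mem_nhds (by linarith : t₀ - ε < t₀) (by linarith : t₀ < t₀ + ε)]
      with t ht using hη t ht
  have hcη : ContinuousAt η t₀ := hη'.self_of_nhds.continuousAt
  have hsol1 : ∀ᶠ t in 𝓝[Set.Icc a b] t₀, HasDerivWithinAt
      (fun t => ((η t).1, (η t).2.comp ((B x₀).comp (dualComp (η t).2))))
      (f (η t).1, (fderiv ℝ f (η t).1).comp ((η t).2.comp ((B x₀).comp (dualComp (η t).2))) +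
        ((η t).2.comp ((B x₀).comp (dualComp (η t).2))).comp (dualComp (fderiv ℝ f (η t).1)))
      (Set.Icc a b) t := by
    refine Filter.Eventually.filter_mono nhdsWithin_le_nhds (hη'.mono fun t ht => ?_)
    have h1 : HasDerivAt (fun t => (η t).1) (f (η t).1) t := ht.fst
    have h2 : HasDerivAt (fun t => (η t).2) ((fderiv ℝ f (η t).1).comp (η t).2) t := ht.snd
    have h3 : HasDerivAt (fun t => dualComp (η t).2)
        (dualComp ((fderiv ℝ f (η t).1).comp (η t).2)) t :=
      (dualComp (E := E)).hasFDerivAt.comp_hasDerivAt t h2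
    have h4 : HasDerivAt (fun t => (B x₀).comp (dualComp (η t).2))
        ((B x₀).comp (dualComp ((fderiv ℝ f (η t).1).comp (η t).2))) t :=
      (ContinuousLinearMap.compL ℝ (E →L[ℝ] ℝ) (E →L[ℝ] ℝ) E (B x₀)).hasFDerivAt.comp_hasDerivAt
        t h3
    exact (h1.prodMk (h2.clm_comp h4)).hasDerivWithinAt
  have hcu : ContinuousWithinAt u (Set.Icc a b) t₀ :=
    (hu.self_of_nhdsWithin ht₀).continuousWithinAt
  have hsol2 : ∀ᶠ t in 𝓝[Set.Icc a b] t₀, HasDerivWithinAt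
      (fun t => (u t, B (u t)))
      (f (u t), (fderiv ℝ f (u t)).comp (B (u t)) + (B (u t)).comp (dualComp (fderiv ℝ f (u t))))
      (Set.Icc a b) t := by
    have hB' := hcu.eventually (by rwa [hu₀])
    filter_upwards [hu, hB'] with t h1 h2
    refine h1.prodMk ?_
    rw [← h2.2]
    exact h2.1.hasFDerivAt.comp_hasDerivWithinAt t h1
  have hη01 : (η t₀).1 = x₀ := by rw [hη0]
  have hη02 : (η t₀).2 = ContinuousLinearMap.id ℝ E := by rw [hη0]
  have heq := hv2.eventuallyEq_of_hasDerivWithinAt_Icc ht₀ hsol2 hsol1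
    (by rw [hu₀]) (by
      rw [hη01, hη02]
      rfl)
  -- `Ψ` is the identity at `t₀` and units are open, so `Ψ` stays invertible for nearby times.
  have hunit : ∀ᶠ t in 𝓝[Set.Icc a b] t₀, IsUnit (η t).2 := by
    refine Filter.Eventually.filter_mono nhdsWithin_le_nhds
      (hcη.snd.eventually_mem (s := {A | IsUnit A}) ?_)
    refine Units.isOpen.mem_nhds ?_
    rw [hη02]
    exact isUnit_one
  filter_upwards [heq, hunit] with t h1 h2
  have h3 : B (u t) = _ := (Prod.ext_iff.1 h1).2
  rw [h3]
  exact finrank_range_conj h2 (B x₀)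

end RankTransport

end PoissonStructure

namespace PoissonStructure

/-! ### Symplectic leaves: constant dimension, open projection, dense regular points. -/

section Leaves

variable {E : Type*} [NormedAddCommGroup E] [NormedSpace ℝ E] [FiniteDimensional ℝ E]
  {P : Type*} [TopologicalSpace P] [ChartedSpace E P] [IsManifold 𝓘(ℝ, E) ∞ P] [T2Space P]
  (S : PoissonStructure E P)

theorem hasDerivWithinAt_chart {p : P} (χ : SmoothBumpFunction 𝓘(ℝ, E) p)
    {H : C^∞⟮𝓘(ℝ, E), P; ℝ⟯} {X : (z : P) → TangentSpace 𝓘(ℝ, E) z}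
    (hX : S.IsHamiltonianVectorField H X) {γ : ℝ → P} {s : Set ℝ}
    (hγ : IsMIntegralCurveOn γ X s) {t : ℝ} (ht : t ∈ s) (htz : γ t ∈ bumpOneSet χ) :
    HasDerivWithinAt (fun t => extChartAt 𝓘(ℝ, E) p (γ t)) (S.hamCoord χ H (γ t)) s t := by
  have h1 := (mdifferentiableAt_extChartAt (I := 𝓘(ℝ, E)) (x := p) (y := γ t)
    (by simpa using htz.1)).hasMFDerivAt.comp_hasMFDerivWithinAt t (hγ t ht)
  refine hasDerivWithinAt_iff_hasFDerivWithinAt.2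
    (hasMFDerivWithinAt_iff_hasFDerivWithinAt.1 (h1.congr_mfderiv ?_))
  refine ContinuousLinearMap.ext fun c => ?_
  have h2 := (S.isHamiltonianVector_iff χ htz H (X (γ t))).1 (hX (γ t))
  rw [← h2]
  have h3 (c : ℝ) : mfderiv 𝓘(ℝ, E) 𝓘(ℝ, E) (extChartAt 𝓘(ℝ, E) p) (γ t) (c • X (γ t)) =
      c • mfderiv 𝓘(ℝ, E) 𝓘(ℝ, E) (extChartAt 𝓘(ℝ, E) p) (γ t) (X (γ t)) := map_smul _ _ _
  exact h3 c

theorem isMIntegralCurveOn_chart_symm {p : P} (χ : SmoothBumpFunction 𝓘(ℝ, E) p)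
    {H : C^∞⟮𝓘(ℝ, E), P; ℝ⟯} {X : (z : P) → TangentSpace 𝓘(ℝ, E) z}
    (hX : S.IsHamiltonianVectorField H X) {α : ℝ → E} {s : Set ℝ}
    (hα : ∀ t ∈ s,
      HasDerivWithinAt α (S.hamCoord χ H ((extChartAt 𝓘(ℝ, E) p).symm (α t))) s t)
    (hαt : ∀ t ∈ s, α t ∈ (extChartAt 𝓘(ℝ, E) p).target ∧
      (extChartAt 𝓘(ℝ, E) p).symm (α t) ∈ bumpOneSet χ) :
    IsMIntegralCurveOn (fun t => (extChartAt 𝓘(ℝ, E) p).symm (α t)) X s := by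
  intro t ht
  obtain ⟨h1, h2⟩ := hαt t ht
  have hd : MDifferentiableAt 𝓘(ℝ, E) 𝓘(ℝ, E) (extChartAt 𝓘(ℝ, E) p).symm (α t) :=
    ((contMDiffOn_extChartAt_symm (n := ∞) p).contMDiffAt
      ((isOpen_extChartAt_target p).mem_nhds h1)).mdifferentiableAt (by simp)
  have h3 := hd.hasMFDerivAt.comp_hasMFDerivWithinAt t
    (hasMFDerivWithinAt_iff_hasFDerivWithinAt.2 (hα t ht).hasFDerivWithinAt)
  refine h3.congr_mfderiv ?_
  set z := (extChartAt 𝓘(ℝ, E) p).symm (α t) with hz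
  have h4 := (S.isHamiltonianVector_iff χ h2 H (X z)).1 (hX z)
  have h5 := mfderivWithin_extChartAt_symm_comp_mfderiv_extChartAt (I := 𝓘(ℝ, E)) h1
  rw [ModelWithCorners.range_eq_univ, mfderivWithin_univ] at h5
  have h6 := congrArg (fun L => L (X z)) h5
  refine ContinuousLinearMap.ext fun c => ?_
  have h7 : mfderiv 𝓘(ℝ, E) 𝓘(ℝ, E) (extChartAt 𝓘(ℝ, E) p).symm (α t) (S.hamCoord χ H z) =
      X z := by
    rw [← h4]
    exact h6
  have h8 (c : ℝ) : ((mfderiv 𝓘(ℝ, E) 𝓘(ℝ, E) (extChartAt 𝓘(ℝ, E) p).symm (α t))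
      (c • S.hamCoord χ H z : E)) = c • X z := by
    rw [← h7]
    exact map_smul _ _ _
  exact h8 c

theorem leafProj_eq_of_reach {x y : P} (h : S.HamiltonianReach x y) :
    S.leafProj x = S.leafProj y :=
  Quotient.sound (Relation.EqvGen.rel _ _ h)

/-- Points on a trajectory of a Hamiltonian vector field lie on the same leaf. -/
theorem leafProj_eq_of_isMIntegralCurveOn {H : C^∞⟮𝓘(ℝ, E), P; ℝ⟯}
    {X : (z : P) → TangentSpace 𝓘(ℝ, E) z} (hX : S.IsHamiltonianVectorField H X) {γ : ℝ → P}
    {s : Set ℝ} (hs : s.OrdConnected) (hγ : IsMIntegralCurveOn γ X s) {t t' : ℝ} (ht : t ∈ s)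
    (ht' : t' ∈ s) : S.leafProj (γ t) = S.leafProj (γ t') := by
  wlog h : t ≤ t' generalizing t t'
  · exact (this ht' ht (le_of_not_ge h)).symm
  · exact S.leafProj_eq_of_reach ⟨H, X, γ, t, t', hX, h, hγ.mono (hs.out ht ht'), rfl, rfl⟩

theorem eventually_chart_trajectory {p : P} (χ : SmoothBumpFunction 𝓘(ℝ, E) p)
    {H : C^∞⟮𝓘(ℝ, E), P; ℝ⟯} {X : (z : P) → TangentSpace 𝓘(ℝ, E) z}
    (hX : S.IsHamiltonianVectorField H X) {γ : ℝ → P} {s : Set ℝ}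
    (hγ : IsMIntegralCurveOn γ X s) {t₀ : ℝ} (ht₀ : t₀ ∈ s) (hp : γ t₀ = p) :
    ∀ᶠ t in 𝓝[s] t₀, γ t ∈ bumpOneSet χ ∧ HasDerivWithinAt
      (fun t => extChartAt 𝓘(ℝ, E) p (γ t)) (S.hamCoord χ H
        ((extChartAt 𝓘(ℝ, E) p).symm (extChartAt 𝓘(ℝ, E) p (γ t)))) s t := by
  have h : ∀ᶠ t in 𝓝[s] t₀, γ t ∈ bumpOneSet χ :=
    (hγ.continuousWithinAt ht₀).eventually_mem
      (by rw [hp]; exact (isOpen_bumpOneSet χ).mem_nhds (mem_bumpOneSet χ))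
  filter_upwards [h, self_mem_nhdsWithin] with t h1 h2
  refine ⟨h1, ?_⟩
  rw [(extChartAt 𝓘(ℝ, E) p).left_inv h1.1]
  exact S.hasDerivWithinAt_chart χ hX hγ h2 h1

theorem eventually_finrank_characteristicSpace_eq {H : C^∞⟮𝓘(ℝ, E), P; ℝ⟯}
    {X : (z : P) → TangentSpace 𝓘(ℝ, E) z} (hX : S.IsHamiltonianVectorField H X) {γ : ℝ → P}
    {a b : ℝ} (hγ : IsMIntegralCurveOn γ X (Set.Icc a b)) {t₀ : ℝ} (ht₀ : t₀ ∈ Set.Icc a b) :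
    ∀ᶠ t in 𝓝[Set.Icc a b] t₀, Module.finrank ℝ (S.characteristicSpace (γ t)) =
      Module.finrank ℝ (S.characteristicSpace (γ t₀)) := by
  obtain ⟨χ⟩ : Nonempty (SmoothBumpFunction 𝓘(ℝ, E) (γ t₀)) := inferInstance
  have hN := mem_bumpOneSet χ
  have h := S.eventually_chart_trajectory χ hX hγ ht₀ rfl
  have hB : ∀ᶠ y in 𝓝 (extChartAt 𝓘(ℝ, E) (γ t₀) (γ t₀)),
      DifferentiableAt ℝ
        (fun y => S.poissonTensor χ ((extChartAt 𝓘(ℝ, E) (γ t₀)).symm y)) y ∧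
      fderiv ℝ (fun y => S.poissonTensor χ ((extChartAt 𝓘(ℝ, E) (γ t₀)).symm y)) y
        (S.hamCoord χ H ((extChartAt 𝓘(ℝ, E) (γ t₀)).symm y)) =
      (fderiv ℝ (fun y => S.hamCoord χ H ((extChartAt 𝓘(ℝ, E) (γ t₀)).symm y)) y).comp
        (S.poissonTensor χ ((extChartAt 𝓘(ℝ, E) (γ t₀)).symm y)) +
      (S.poissonTensor χ ((extChartAt 𝓘(ℝ, E) (γ t₀)).symm y)).comp (dualComp
        (fderiv ℝ (fun y => S.hamCoord χ H ((extChartAt 𝓘(ℝ, E) (γ t₀)).symm y)) y)) := by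
    filter_upwards [symm_eventually_mem_bumpOneSet χ hN] with y hy
    refine ⟨(S.contDiffAt_poissonTensor χ hy.1).differentiableAt (by simp), ?_⟩
    have := S.fderiv_poissonTensor χ hy.2 H
    rwa [(extChartAt 𝓘(ℝ, E) (γ t₀)).right_inv hy.1] at this
  have hr := eventually_finrank_range_eq
    (S.contDiffAt_hamCoord χ H ((extChartAt 𝓘(ℝ, E) (γ t₀)).map_source hN.1)) hB ht₀
    (h.mono fun t ht => ht.2) rfl
  filter_upwards [hr, h] with t h1 h2
  rw [S.finrank_characteristicSpace χ h2.1, S.finrank_characteristicSpace χ hN]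
  rwa [(extChartAt 𝓘(ℝ, E) (γ t₀)).left_inv h2.1.1,
    (extChartAt 𝓘(ℝ, E) (γ t₀)).left_inv hN.1] at h1

/-- The dimension of the characteristic distribution is constant on the leaves. -/
theorem finrank_characteristicSpace_eq_of_leafProj_eq {x y : P}
    (h : S.leafProj x = S.leafProj y) :
    Module.finrank ℝ (S.characteristicSpace x) = Module.finrank ℝ (S.characteristicSpace y) := by
  have h' : Relation.EqvGen S.HamiltonianReach x y := Quotient.exact h
  clear h
  induction h' with
  | rel x y hxy =>
    obtain ⟨H, X, γ, a, b, hX, hab, hγ, rfl, rfl⟩ := hxy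
    -- Local constancy along the trajectory becomes constancy because the time interval is
    -- connected.
    exact isPreconnected_Icc.induction₂
      (fun t t' => Module.finrank ℝ (S.characteristicSpace (γ t)) =
        Module.finrank ℝ (S.characteristicSpace (γ t')))
      (fun t ht => (S.eventually_finrank_characteristicSpace_eq hX hγ ht).mono
        fun _ h => h.symm) (fun _ _ _ _ _ _ h1 h2 => h1.trans h2)
      (fun _ _ _ _ h => h.symm) (Set.left_mem_Icc.2 hab) (Set.right_mem_Icc.2 hab)
  | refl x => rfl
  | symm x y _ ih => exact ih.symm
  | trans x y z _ _ ih1 ih2 => exact ih1.trans ih2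

/-- If `γ t` is interior to the saturated set `A`, the local flow up to time `t` carries a
neighbourhood of `γ t₀` into `A` by continuity. Flow lines stay in leaves, so that neighbourhood
already lies in `A`. The other direction is continuity of `γ`. -/
theorem eventually_mem_interior_iff {A : Set P}
    (hA : ∀ x y, S.leafProj x = S.leafProj y → x ∈ A → y ∈ A) {H : C^∞⟮𝓘(ℝ, E), P; ℝ⟯}
    {X : (z : P) → TangentSpace 𝓘(ℝ, E) z} (hX : S.IsHamiltonianVectorField H X) {γ : ℝ → P}
    {a b : ℝ} (hγ : IsMIntegralCurveOn γ X (Set.Icc a b)) {t₀ : ℝ} (ht₀ : t₀ ∈ Set.Icc a b) :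
    ∀ᶠ t in 𝓝[Set.Icc a b] t₀, (γ t₀ ∈ interior A ↔ γ t ∈ interior A) := by
  have : CompleteSpace E := FiniteDimensional.complete ℝ E
  by_cases h0 : γ t₀ ∈ interior A
  · filter_upwards [(hγ.continuousWithinAt ht₀).eventually_mem (isOpen_interior.mem_nhds h0)]
      with t ht using iff_of_true h0 ht
  obtain ⟨χ⟩ : Nonempty (SmoothBumpFunction 𝓘(ℝ, E) (γ t₀)) := inferInstance
  set φ := extChartAt 𝓘(ℝ, E) (γ t₀) with hφ
  have hN := mem_bumpOneSet χ
  have h := S.eventually_chart_trajectory χ hX hγ ht₀ rfl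
  have hf := (S.contDiffAt_hamCoord χ H (φ.map_source hN.1)).of_le (m := 1) (by simp)
  obtain ⟨α, r, hr, ε, hε, hα, hc⟩ := hf.exists_continuous_localFlow t₀
    (symm_eventually_mem_bumpOneSet χ hN)
  have hcurve : ∀ x ∈ Metric.ball (φ (γ t₀)) r, IsMIntegralCurveOn
      (fun t => φ.symm (α x t)) X (Set.Icc (t₀ - ε) (t₀ + ε)) := fun x hx =>
    S.isMIntegralCurveOn_chart_symm χ hX (fun t ht => ((hα x hx).2 t ht).1)
      (fun t ht => ((hα x hx).2 t ht).2)
  have ht₀ε : t₀ ∈ Set.Icc (t₀ - ε) (t₀ + ε) := ⟨by linarith, by linarith⟩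
  have hIoo : Set.Ioo (t₀ - ε) (t₀ + ε) ∈ 𝓝 t₀ := Ioo_mem_nhds (by linarith) (by linarith)
  have hx₀ : φ (γ t₀) ∈ Metric.ball (φ (γ t₀)) r := Metric.mem_ball_self hr
  -- Uniqueness identifies the given trajectory, read in the chart, with the flow line through its
  -- initial point.
  have heq := hf.eventuallyEq_of_hasDerivWithinAt_Icc ht₀ (h.mono fun t ht => ht.2)
    (w := α (φ (γ t₀))) (by
      filter_upwards [mem_nhdsWithin_of_mem_nhds hIoo] with t ht
      exact ((((hα _ hx₀).2 t (Set.Ioo_subset_Icc_self ht)).1).hasDerivAt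
        (Icc_mem_nhds ht.1 ht.2)).hasDerivWithinAt) rfl (hα _ hx₀).1
  filter_upwards [heq, h, mem_nhdsWithin_of_mem_nhds hIoo] with t h1 h2 h3
  have h3' := Set.Ioo_subset_Icc_self h3
  refine iff_of_false h0 fun hmem => h0 ?_
  have hαt : φ.symm (α (φ (γ t₀)) t) = γ t := by
    rw [← h1]
    exact φ.left_inv h2.1.1
  have hcont : ContinuousAt (fun x => φ.symm (α x t)) (φ (γ t₀)) := by
    refine ContinuousAt.comp (g := φ.symm) ?_ (hc t h3')
    exact continuousAt_extChartAt_symm'' ((hα _ hx₀).2 t h3').2.1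
  have hev : ∀ᶠ x in 𝓝 (φ (γ t₀)), φ.symm (α x t) ∈ interior A :=
    hcont.eventually_mem (by rw [hαt]; exact isOpen_interior.mem_nhds hmem)
  have hev' : ∀ᶠ y in 𝓝 (γ t₀), φ.symm (α (φ y) t) ∈ interior A ∧ φ y ∈ Metric.ball (φ (γ t₀)) r ∧
      y ∈ φ.source :=
    ((continuousAt_extChartAt (I := 𝓘(ℝ, E)) (γ t₀)).eventually
      (hev.and (Metric.isOpen_ball.mem_nhds hx₀))).and
      (extChartAt_source_mem_nhds (I := 𝓘(ℝ, E)) (γ t₀)) |>.mono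
        fun y hy => ⟨hy.1.1, hy.1.2, hy.2⟩
  refine mem_interior_iff_mem_nhds.2 (hev'.mono fun y hy => ?_)
  have hleaf := S.leafProj_eq_of_isMIntegralCurveOn hX Set.ordConnected_Icc
    (hcurve _ hy.2.1) h3' ht₀ε
  rw [(hα _ hy.2.1).1, φ.left_inv hy.2.2] at hleaf
  exact hA _ _ hleaf (interior_subset hy.1)

/-- The projection onto the space of symplectic leaves is open. -/
theorem isOpenMap_leafProj : IsOpenMap S.leafProj := by
  intro U hU
  change IsOpen (S.leafProj ⁻¹' (S.leafProj '' U))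
  set A := S.leafProj ⁻¹' (S.leafProj '' U) with hAdef
  have hA : ∀ x y, S.leafProj x = S.leafProj y → x ∈ A → y ∈ A := fun x y h hx => by
    rw [hAdef, Set.mem_preimage, ← h]
    exact hx
  -- The interior of the saturation `A` is itself saturated. It contains `U`, whose leaves fill `A`,
  -- so `A` is open.
  have hreach : ∀ x y, Relation.EqvGen S.HamiltonianReach x y →
      (x ∈ interior A ↔ y ∈ interior A) := by
    intro x y h
    induction h with
    | rel x y hxy =>
      obtain ⟨H, X, γ, a, b, hX, hab, hγ, rfl, rfl⟩ := hxy
      exact isPreconnected_Icc.induction₂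
        (fun t t' => (γ t ∈ interior A ↔ γ t' ∈ interior A))
        (fun t ht => S.eventually_mem_interior_iff hA hX hγ ht)
        (fun _ _ _ _ _ _ h1 h2 => h1.trans h2)
        (fun _ _ _ _ h => h.symm) (Set.left_mem_Icc.2 hab) (Set.right_mem_Icc.2 hab)
    | refl x => rfl
    | symm x y _ ih => exact ih.symm
    | trans x y z _ _ ih1 ih2 => exact ih1.trans ih2
  refine isOpen_iff_mem_nhds.2 fun y hy => mem_interior_iff_mem_nhds.1 ?_
  obtain ⟨x, hx, hxy⟩ := hy
  refine (hreach x y (Quotient.exact hxy)).1 (mem_interior_iff_mem_nhds.2 ?_)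
  exact Filter.mem_of_superset (hU.mem_nhds hx) fun w hw => ⟨w, hw, rfl⟩

theorem isOpen_setOf_isRegularPoint : IsOpen {z | S.IsRegularPoint z} := by
  refine isOpen_iff_mem_nhds.2 fun z hz => ?_
  have h := eventually_eventually_nhds.2 hz
  filter_upwards [h] with w hw
  filter_upwards [hw] with v hv
  rw [hv, hw.self_of_nhds]

/-- The leaf through a regular point is regular. -/
theorem IsRegularPoint.isRegularLeaf {S : PoissonStructure E P} {z : P}
    (hz : S.IsRegularPoint z) : S.IsRegularLeaf (S.leafProj z) := by
  intro w hw
  obtain ⟨V, hV, hVo, hzV⟩ := eventually_nhds_iff.1 hz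
  -- The saturation of `V` is open, contains the whole leaf, and has constant rank since rank is
  -- constant on leaves.
  have hopen : IsOpen (S.leafProj ⁻¹' (S.leafProj '' V)) :=
    (S.isOpenMap_leafProj V hVo).preimage continuous_quotient_mk'
  have hrank : ∀ v, v ∈ S.leafProj ⁻¹' (S.leafProj '' V) →
      Module.finrank ℝ (S.characteristicSpace v) =
        Module.finrank ℝ (S.characteristicSpace z) := by
    rintro v ⟨x, hx, hxv⟩
    rw [← S.finrank_characteristicSpace_eq_of_leafProj_eq hxv]
    exact hV x hx
  have hwm : w ∈ S.leafProj ⁻¹' (S.leafProj '' V) := ⟨z, hzV, hw.symm⟩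
  filter_upwards [hopen.mem_nhds hwm] with v hv
  rw [hrank v hv, hrank w hwm]

/-- The dimension of the characteristic distribution is lower semicontinuous. -/
theorem eventually_le_finrank_characteristicSpace (z : P) :
    ∀ᶠ w in 𝓝 z, Module.finrank ℝ (S.characteristicSpace z) ≤
      Module.finrank ℝ (S.characteristicSpace w) := by
  obtain ⟨χ⟩ : Nonempty (SmoothBumpFunction 𝓘(ℝ, E) z) := inferInstance
  have hN := mem_bumpOneSet χ
  -- Having rank at least `n` is an open condition on linear maps, and the tensor depends
  -- continuously on the point.
  have hopen := isOpen_setOfPred_nat_le_rank (𝕜 := ℝ) (E := E →L[ℝ] ℝ) (F := E)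
    (Module.finrank ℝ (S.characteristicSpace z))
  have hmem : ∀ w ∈ bumpOneSet χ, (S.poissonTensor χ w ∈ {f : (E →L[ℝ] ℝ) →L[ℝ] E |
      (Module.finrank ℝ (S.characteristicSpace z) : Cardinal) ≤
        (f : (E →L[ℝ] ℝ) →ₗ[ℝ] E).rank} ↔ Module.finrank ℝ (S.characteristicSpace z) ≤
      Module.finrank ℝ (S.characteristicSpace w)) := fun w hw => by
    rw [Set.mem_ofPred_eq, LinearMap.rank, ← Module.finrank_eq_rank, Nat.cast_le,
      S.finrank_characteristicSpace χ hw]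
  filter_upwards [(isOpen_bumpOneSet χ).mem_nhds hN,
    (S.continuous_poissonTensor χ).continuousAt.eventually_mem
      (hopen.mem_nhds ((hmem z hN).2 le_rfl))] with w h1 h2
  exact (hmem w h1).1 h2

theorem finrank_characteristicSpace_le (z : P) :
    Module.finrank ℝ (S.characteristicSpace z) ≤ Module.finrank ℝ E := by
  have : FiniteDimensional ℝ (TangentSpace 𝓘(ℝ, E) z) := inferInstanceAs (FiniteDimensional ℝ E)
  exact Submodule.finrank_le (S.characteristicSpace z)

/-- On an open set the dimension, bounded by that of `E`, attains a maximum. Lower semicontinuity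
makes it constant near a maximizer. -/
theorem dense_setOf_isRegularPoint : Dense {z | S.IsRegularPoint z} := by
  refine dense_iff_inter_open.2 fun U hU hne => ?_
  let R : Set ℕ := (fun z => Module.finrank ℝ (S.characteristicSpace z)) '' U
  have hb : BddAbove R := ⟨Module.finrank ℝ E, by
    rintro _ ⟨z, _, rfl⟩
    exact S.finrank_characteristicSpace_le z⟩
  obtain ⟨z, hz, hmax⟩ := Nat.sSup_mem (hne.image _ : R.Nonempty) hb
  refine ⟨z, hz, ?_⟩
  filter_upwards [hU.mem_nhds hz, S.eventually_le_finrank_characteristicSpace z] with w h1 h2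
  refine le_antisymm ?_ h2
  exact (le_csSup hb ⟨w, h1, rfl⟩).trans hmax.ge

end Leaves

end PoissonStructure

/-! ### `T̄₂`-sets and continuous Casimirs -/

section T2Sets

variable {X : Type*} [TopologicalSpace X]

theorem mem_T2Set_self (x : X) : x ∈ T2Set x := fun _ _ _ _ hU hV => ⟨x, hU, hV⟩

theorem mem_T2Set_symm {x y : X} (h : y ∈ T2Set x) : x ∈ T2Set y := fun U V hU hV hy hx =>
  Set.inter_comm U V ▸ h V U hV hU hx hy

/-- Continuous maps to Hausdorff spaces do not distinguish points of a `T₂`-set. -/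
theorem eq_of_mem_T2Set {Y : Type*} [TopologicalSpace Y] [T2Space Y] {f : X → Y}
    (hf : Continuous f) {x y : X} (h : y ∈ T2Set x) : f x = f y := by
  by_contra hne
  obtain ⟨U, V, hU, hV, hx, hy, hd⟩ := t2_separation hne
  obtain ⟨w, hwU, hwV⟩ := h (f ⁻¹' U) (f ⁻¹' V) (hU.preimage hf) (hV.preimage hf) hx hy
  exact Set.disjoint_left.1 hd hwU hwV

end T2Sets

namespace PoissonStructure

section Casimirs

variable {E : Type*} [NormedAddCommGroup E] [NormedSpace ℝ E]
  {P : Type u} [TopologicalSpace P] [ChartedSpace E P] (S : PoissonStructure E P)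

theorem continuous_leafProj : Continuous S.leafProj := continuous_quotient_mk'

theorem mem_T2Bar_self (z : P) : z ∈ S.T2Bar z := mem_T2Set_self _

variable {S}

theorem mem_T2Bar_symm {x y : P} (h : y ∈ S.T2Bar x) : x ∈ S.T2Bar y := mem_T2Set_symm h

theorem IsContinuousCasimir.eq_of_mem_T2Bar {C : P → ℝ} (hC : S.IsContinuousCasimir C)
    {x y : P} (h : y ∈ S.T2Bar x) : C x = C y :=
  eq_of_mem_T2Set (f := Quotient.lift C fun a b hab => hC.2 a b (Quotient.sound hab))
    (hC.1.quotient_lift _) h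

/-- `T̄₂(z)` lies in the level set of any family of continuous Casimirs, which gives one direction;
for the other, the family `C` cuts out exactly `T̄₂(z)`. -/
theorem continuousCriterion_iff_topologicalCriterion {I : Type*} {C : I → P → ℝ}
    (hC : ∀ i, S.IsContinuousCasimir (C i)) (hT : ∀ z, S.T2Bar z = ⋂ i, C i ⁻¹' {C i z})
    {Y : Type*} (F : P → Y) (z : P) :
    S.ContinuousEnergyCasimirCriterion F z ↔ S.TopologicalEnergyCasimirCriterion F z := by
  constructor
  · rintro ⟨𝒞, h𝒞, h⟩
    refine Set.Subset.antisymm (fun y hy => ?_) ?_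
    · rw [← h]
      exact ⟨hy.1, Set.mem_iInter₂.2 fun D hD => ((h𝒞 D hD).eq_of_mem_T2Bar hy.2).symm⟩
    · rintro _ rfl
      exact ⟨rfl, S.mem_T2Bar_self _⟩
  · intro h
    refine ⟨Set.range C, ?_, ?_⟩
    · rintro _ ⟨i, rfl⟩
      exact hC i
    · rw [Set.biInter_range, ← hT]
      exact h

/-- Common level sets are the classes of an equivalence relation, and transitivity is idempotency.
-/
theorem isT2BarIdempotent_of_eq_iInter {I : Type*} {C : I → P → ℝ}
    (hT : ∀ z, S.T2Bar z = ⋂ i, C i ⁻¹' {C i z}) : S.IsT2BarIdempotent := by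
  refine fun z => Set.Subset.antisymm (fun y hy => ?_) fun y hy => ?_
  · obtain ⟨w, hw, hyw⟩ := Set.mem_iUnion₂.1 hy
    rw [hT, Set.mem_iInter] at hw hyw ⊢
    exact fun i => (hyw i).trans (hw i)
  · exact Set.mem_iUnion₂.2 ⟨z, S.mem_T2Bar_self z, hy⟩

theorem IsT2BarIdempotent.equivalence (h : S.IsT2BarIdempotent) : Equivalence S.T2BarRel where
  refl := S.mem_T2Bar_self
  symm := mem_T2Bar_symm
  trans := fun {x y z} hxy hyz => by
    change z ∈ S.T2Bar x
    rw [← h x]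
    exact Set.mem_iUnion₂.2 ⟨y, hxy, hyz⟩

theorem IsT2BarIdempotent.t2BarProj_eq_iff (h : S.IsT2BarIdempotent) {x y : P} :
    S.t2BarProj x = S.t2BarProj y ↔ y ∈ S.T2Bar x := by
  unfold t2BarProj
  rw [Quot.eq, h.equivalence.eqvGen_iff]
  rfl

/-- The relation `y ∈ T̄₂(x)` is closed. -/
theorem isClosed_setOf_mem_T2Bar : IsClosed {q : P × P | q.2 ∈ S.T2Bar q.1} := by
  refine isOpen_compl_iff.1 (isOpen_iff_mem_nhds.2 fun q hq => ?_)
  have h : ∃ U V : Set S.LeafSpace, IsOpen U ∧ IsOpen V ∧ S.leafProj q.1 ∈ U ∧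
      S.leafProj q.2 ∈ V ∧ ¬(U ∩ V).Nonempty := by
    by_contra hcon
    push Not at hcon
    refine hq fun U V hU hV h1 h2 => ?_
    exact hcon U V hU hV h1 h2
  obtain ⟨U, V, hU, hV, h1, h2, hUV⟩ := h
  filter_upwards [prod_mem_nhds ((hU.preimage S.continuous_leafProj).mem_nhds h1)
    ((hV.preimage S.continuous_leafProj).mem_nhds h2)] with q' hq' hmem
  exact hUV (hmem U V hU hV hq'.1 hq'.2)

/-- The `R`-saturation of `U` is the preimage under the joint map of the image of `U`. -/
theorem isOpenMap_t2BarProj_of_eq_iInter {I : Type*} {C : I → P → ℝ}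
    (hC : ∀ i, S.IsContinuousCasimir (C i)) (hT : ∀ z, S.T2Bar z = ⋂ i, C i ⁻¹' {C i z})
    (hopen : IsOpenMap (Set.rangeFactorization (fun (z : P) (i : I) => C i z))) :
    IsOpenMap S.t2BarProj := by
  have hcont : Continuous (Set.rangeFactorization (fun (z : P) (i : I) => C i z)) :=
    (continuous_pi fun i => (hC i).1).subtype_mk _
  have hid := isT2BarIdempotent_of_eq_iInter hT
  intro U hU
  change IsOpen (S.t2BarProj ⁻¹' (S.t2BarProj '' U))
  convert (hopen U hU).preimage hcont using 1
  ext x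
  refine exists_congr fun y => and_congr_right fun _ => ?_
  rw [hid.t2BarProj_eq_iff, hT, Set.mem_iInter, Subtype.ext_iff]
  exact ⟨fun h => funext fun i => (h i).symm, fun h i => (congrFun h i).symm⟩

/-- If `P` is `T̄₂`-idempotent with open projection `π_{T̄₂}`, the continuous Casimirs that factor
through `π_{T̄₂}` cut out the `T̄₂`-sets. -/
theorem IsT2BarIdempotent.T2Bar_eq_iInter [FiniteDimensional ℝ E] (hid : S.IsT2BarIdempotent)
    (hopen : IsOpenMap S.t2BarProj) :
    (∀ f : C(Quot S.T2BarRel, ℝ), S.IsContinuousCasimir fun z => f (S.t2BarProj z)) ∧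
    ∀ z, S.T2Bar z = ⋂ f : C(Quot S.T2BarRel, ℝ),
      (fun z => f (S.t2BarProj z)) ⁻¹' {f (S.t2BarProj z)} := by
  have hq : IsOpenQuotientMap S.t2BarProj :=
    ⟨Quot.mk_surjective, continuous_quot_mk, hopen⟩
  have : LocallyCompactSpace P := Manifold.locallyCompact_of_finiteDimensional 𝓘(ℝ, E)
  have : LocallyCompactSpace (Quot S.T2BarRel) := hq.locallyCompactSpace
  -- For an open quotient map, a closed relation gives a Hausdorff quotient.
  have : T2Space (Quot S.T2BarRel) := by
    rw [t2Space_iff_of_isOpenQuotientMap hq]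
    simp only [hid.t2BarProj_eq_iff]
    exact isClosed_setOf_mem_T2Bar
  refine ⟨fun f => ⟨f.continuous.comp hq.continuous, fun x y hxy => ?_⟩, fun z => ?_⟩
  · refine congrArg f (hid.t2BarProj_eq_iff.2 ?_)
    change S.leafProj y ∈ T2Set (S.leafProj x)
    rw [hxy]
    exact mem_T2Set_self _
  · refine Set.Subset.antisymm (fun y hy => Set.mem_iInter.2 fun f => ?_) fun y hy => ?_
    · exact (congrArg f (hid.t2BarProj_eq_iff.2 hy)).symm
    · rw [← hid.t2BarProj_eq_iff]
      by_contra hne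
      -- Urysohn in a locally compact Hausdorff space separates the two classes.
      obtain ⟨f, h0, h1, -⟩ := exists_continuous_zero_one_of_isCompact
        (isCompact_singleton (x := S.t2BarProj z)) (isClosed_singleton (x := S.t2BarProj y))
        (Set.disjoint_singleton.2 hne)
      have hf : f (S.t2BarProj y) = f (S.t2BarProj z) := Set.mem_iInter.1 hy f
      rw [h0 rfl, h1 rfl] at hf
      exact one_ne_zero hf

/-- Continuous Casimirs that separate the regular leaves and are jointly open onto their image cut
out the `T̄₂`-sets. -/
theorem T2Bar_eq_iInter_of_separatesRegularLeaves [FiniteDimensional ℝ E]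
    [IsManifold 𝓘(ℝ, E) ∞ P] [T2Space P] {I : Type*} {C : I → P → ℝ}
    (hC : ∀ i, S.IsContinuousCasimir (C i)) (hsep : S.SeparatesRegularLeaves C)
    (hopen : IsOpenMap (Set.rangeFactorization (fun (z : P) (i : I) => C i z))) (z : P) :
    S.T2Bar z = ⋂ i, C i ⁻¹' {C i z} := by
  refine Set.Subset.antisymm
    (fun y hy => Set.mem_iInter.2 fun i => ((hC i).eq_of_mem_T2Bar hy).symm) fun y hy => ?_
  intro U V hU hV hzU hyV
  set Φ := Set.rangeFactorization (fun (z : P) (i : I) => C i z) with hΦ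
  have hcont : Continuous Φ := (continuous_pi fun i => (hC i).1).subtype_mk _
  have hΦC : ∀ {a b : P}, Φ a = Φ b ↔ ∀ i, C i a = C i b := fun {a b} => by
    rw [Subtype.ext_iff]
    exact funext_iff
  have hyz : Φ y = Φ z := hΦC.2 (Set.mem_iInter.1 hy)
  have hU' := hU.preimage S.continuous_leafProj
  have hV' := hV.preimage S.continuous_leafProj
  -- Only `u` is regular here; its partner `v'` in `V` need not be.
  obtain ⟨u, ⟨huU, v', hv'V, huv'⟩, hu⟩ := S.dense_setOf_isRegularPoint.inter_open_nonempty
    (S.leafProj ⁻¹' U ∩ Φ ⁻¹' (Φ '' (S.leafProj ⁻¹' V)))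
    (hU'.inter ((hopen _ hV').preimage hcont)) ⟨z, hzU, y, hyV, hyz⟩
  -- Regular points of `U` form an open set, so density applies again: now `v ∈ V` is regular and
  -- its partner `w` is taken among the regular points of `U`.
  obtain ⟨v, ⟨hvV, w, ⟨hwU, hw⟩, hwv⟩, hv⟩ := S.dense_setOf_isRegularPoint.inter_open_nonempty
    (S.leafProj ⁻¹' V ∩ Φ ⁻¹' (Φ '' (S.leafProj ⁻¹' U ∩ {z | S.IsRegularPoint z})))
    (hV'.inter ((hopen _ (hU'.inter S.isOpen_setOf_isRegularPoint)).preimage hcont))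
    ⟨v', hv'V, u, ⟨huU, hu⟩, huv'.symm⟩
  have hleaf : S.leafProj w = S.leafProj v := by
    by_contra hne
    obtain ⟨i, hi⟩ := hsep w v (IsRegularPoint.isRegularLeaf hw) (IsRegularPoint.isRegularLeaf hv)
      hne
    exact hi (hΦC.1 hwv i)
  exact ⟨S.leafProj v, hleaf ▸ hwU, hvV⟩

end Casimirs

end PoissonStructure

/-! ### Both parts of the theorem assembled. -/

theorem theorem4p13 {E : Type*} [NormedAddCommGroup E] [NormedSpace ℝ E]
    [FiniteDimensional ℝ E] {P : Type u} [TopologicalSpace P] [ChartedSpace E P]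
    [IsManifold 𝓘(ℝ, E) ∞ P] [T2Space P] [SecondCountableTopology P]
    (S : PoissonStructure E P) :
    (∀ (I : Type*) (C : I → P → ℝ),
      (∀ i, S.IsContinuousCasimir (C i)) →
      S.SeparatesRegularLeaves C →
      IsOpenMap (Set.rangeFactorization (fun (z : P) (i : I) => C i z)) →
        S.IsT2BarIdempotent ∧ IsOpenMap S.t2BarProj ∧
        (∀ z, S.T2Bar z = ⋂ i, C i ⁻¹' {C i z}) ∧
        (∀ (Y : Type*) [TopologicalSpace Y] [T2Space Y] (F : P → Y), Continuous F → ∀ z,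
          (S.ContinuousEnergyCasimirCriterion F z ↔ S.TopologicalEnergyCasimirCriterion F z))) ∧
    (S.IsT2BarIdempotent → IsOpenMap S.t2BarProj →
        (∃ (I : Type u) (C : I → P → ℝ), (∀ i, S.IsContinuousCasimir (C i)) ∧
          ∀ z, S.T2Bar z = ⋂ i, C i ⁻¹' {C i z}) ∧
        (∀ (Y : Type*) [TopologicalSpace Y] [T2Space Y] (F : P → Y), Continuous F → ∀ z,
          (S.ContinuousEnergyCasimirCriterion F z ↔
            S.TopologicalEnergyCasimirCriterion F z))) := by
  refine ⟨fun I C hC hsep hopen => ?_, fun hid hopen => ?_⟩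
  · have hT := PoissonStructure.T2Bar_eq_iInter_of_separatesRegularLeaves hC hsep hopen
    exact ⟨PoissonStructure.isT2BarIdempotent_of_eq_iInter hT,
      PoissonStructure.isOpenMap_t2BarProj_of_eq_iInter hC hT hopen, hT,
      fun Y _ _ F _ z => PoissonStructure.continuousCriterion_iff_topologicalCriterion hC hT F z⟩
  · obtain ⟨hC, hT⟩ := hid.T2Bar_eq_iInter hopen
    exact ⟨⟨_, _, hC, hT⟩, fun Y _ _ F _ z =>
      PoissonStructure.continuousCriterion_iff_topologicalCriterion hC hT F z⟩
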